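/- Let $1\le p<\infty$ and let $\mu$ be a Borel probability measure on $[0,+\infty)$ whose support contains $0$ (in particular, any such measure carried by $(0,+\infty)$). A Dirichlet polynomial is a finite sum $P(s)=\sum_{n\ge 1} a_n n^{-s}$ with complex coefficients; for $\sigma\ge 0$ put $P_\sigma(s)=P(s+\sigma)$. Let $\mathbb T^\infty$ be the product of circles indexed by the primes, with normalized Haar measure $m$. For $\chi\in\mathbb T^\infty$ let $\chi(n)$ be the completely multiplicative extension of $\chi$ from the primes to the positive integers, and let $D(P)(\chi)=\sum_n a_n\chi(n)$. Put $$\|P\|_{\mathcal H^p}=\Big(\int_{\mathbb T^\infty}|D(P)|^p\,dm\Big)^{1/p},\qquad \|P\|_{\mathcal A^p_\mu}=\Big(\int_{[0,+\infty)}\|P_\sigma\|_{\mathcal H^p}^p\,d\mu(\sigma)\Big)^{1/p}.$$ The spaces $\mathcal H^p$ and $\mathcal A^p_\mu$ are the completions of the space of Dirichlet polynomials for these two norms. An element of either completion is regarded as a function on $\mathbb C_{1/2}=\{s\in\mathbb C:\operatorname{Re}s>1/2\}$, whose value at $s$ is given by the continuous extension to the completion of the point evaluation $P\mapsto P(s)$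 (this evaluation is bounded, and an element of the completion is determined by its function). For a function $f$ on $\mathbb C_{1/2}$ and $\sigma\ge0$ put $f_\sigma(s)=f(s+\sigma)$. Then: (i) $\mathcal H^p\subset\mathcal A^p_\mu$ and $\|f\|_{\mathcal A^p_\mu}\le\|f\|_{\mathcal H^p}$ for every $f\in\mathcal H^p$. (ii) For every $f\in\mathcal H^p$, one has $f_\sigma\in\mathcal H^p$ for all $\sigma\ge0$, the function $\sigma\mapsto\|f_\sigma\|_{\mathcal H^p}^p$ is $\mu$-integrable, and $$\|f\|_{\mathcal A^p_\mu}=\Big(\int_{[0,+\infty)}\|f_\sigma\|_{\mathcal H^p}^p\,d\mu(\sigma)\Big)^{1/p}.$$ (iii) For every $f\in\mathcal A^p_\mu$, one has $f_c\in\mathcal A^p_\mu$ for all $c>0$, and $$\|f\|_{\mathcal A^p_\mu}=\lim_{c\to0^+}\|f_c\|_{\mathcal A^p_\mu}.$$ -/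

import Mathlib

open MeasureTheory Filter Topology
open scoped NNReal ENNReal

noncomputable section

namespace DirichletSeries

/-! ### The infinite polytorus and Dirichlet polynomials -/

instance : MeasurableSpace Circle := borel Circle

instance : BorelSpace Circle := ⟨rfl⟩

instance : SecondCountableTopology Circle :=
  inferInstanceAs (SecondCountableTopology (Submonoid.unitSphere ℂ : Set ℂ))

/-- The infinite-dimensional polytorus, one circle for each prime number. -/
abbrev Polytorus : Type := Nat.Primes → Circle

/-- The normalized Haar measure of the compact group `Polytorus`. -/
def haar : Measure Polytorus := Measure.haarMeasure ⊤

instance : IsProbabilityMeasure haar :=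
  ⟨by rw [haar, ← TopologicalSpace.PositiveCompacts.coe_top, Measure.haarMeasure_self]⟩

/-- The completely multiplicative character of the positive integers given by a point `χ` of the
polytorus: the product of the `χ q` over the prime factors `q` of `n`, with multiplicity. -/
def character (χ : Polytorus) (n : ℕ+) : Circle :=
  (Multiset.map χ (PNat.factorMultiset n)).prod

/-- Dirichlet polynomials `∑ aₙ n⁻ˢ`, given by their finitely many nonzero coefficients `aₙ`. -/
abbrev DirichletPoly : Type := ℕ+ →₀ ℂ

/-- The value `P(s) = ∑ aₙ n⁻ˢ`. -/
def DirichletPoly.eval (P : DirichletPoly) (s : ℂ) : ℂ :=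
  P.sum fun n a => a * ((n : ℕ) : ℂ) ^ (-s)

/-- The translate `P_σ(s) = P(s + σ)`, whose coefficients are `aₙ n^(-σ)`. -/
def DirichletPoly.shift (σ : ℝ≥0) (P : DirichletPoly) : DirichletPoly :=
  Finsupp.onFinset P.support (fun n => P n * ((n : ℕ) : ℂ) ^ (-((σ : ℝ) : ℂ)))
    (fun _ h => Finsupp.mem_support_iff.2 (left_ne_zero_of_mul h))

/-- The Bohr lift `D(P)(χ) = ∑ aₙ χ(n)`, an analytic polynomial on the polytorus. -/
def DirichletPoly.bohr (P : DirichletPoly) (χ : Polytorus) : ℂ :=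
  P.sum fun n a => a * (character χ n : ℂ)

/-- The Hardy norm `‖P‖_{𝓗^p} = (∫ |D(P)|^p dm)^{1/p}` of a Dirichlet polynomial. -/
def polyHardyNorm (p : ℝ) (P : DirichletPoly) : ℝ :=
  (∫ χ, ‖P.bohr χ‖ ^ p ∂haar) ^ (1 / p)

/-- The Bergman norm `‖P‖_{𝓐^p_μ} = (∫ ‖P_σ‖_{𝓗^p}^p dμ(σ))^{1/p}` of a Dirichlet polynomial. -/
def polyBergmanNorm (p : ℝ) (μ : Measure ℝ≥0) (P : DirichletPoly) : ℝ :=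
  (∫ σ, polyHardyNorm p (P.shift σ) ^ p ∂μ) ^ (1 / p)

/-! ### These expressions are seminorms -/

theorem DirichletPoly.shift_eval (σ : ℝ≥0) (P : DirichletPoly) (s : ℂ) :
    (P.shift σ).eval s = P.eval (s + ((σ : ℝ) : ℂ)) := by
  unfold DirichletPoly.eval DirichletPoly.shift
  rw [Finsupp.onFinset_sum _ (by simp)]
  refine Finset.sum_congr rfl fun n _ => ?_
  rw [mul_assoc, ← Complex.cpow_add _ _ (by exact_mod_cast n.ne_zero)]
  congr 2
  ring

theorem DirichletPoly.shift_add (σ : ℝ≥0) (P Q : DirichletPoly) :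
    (P + Q).shift σ = P.shift σ + Q.shift σ := by
  ext n
  simp [DirichletPoly.shift, add_mul]

theorem DirichletPoly.shift_neg (σ : ℝ≥0) (P : DirichletPoly) :
    (-P).shift σ = -P.shift σ := by
  ext n
  simp [DirichletPoly.shift]

theorem DirichletPoly.shift_zero_poly (σ : ℝ≥0) : (0 : DirichletPoly).shift σ = 0 := by
  ext n
  simp [DirichletPoly.shift]

theorem DirichletPoly.bohr_add (P Q : DirichletPoly) (χ : Polytorus) :
    (P + Q).bohr χ = P.bohr χ + Q.bohr χ :=
  Finsupp.sum_add_index' (by simp) (by intros; ring)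

theorem DirichletPoly.bohr_neg (P : DirichletPoly) (χ : Polytorus) :
    (-P).bohr χ = -P.bohr χ := by
  unfold DirichletPoly.bohr
  rw [Finsupp.sum_neg_index (by simp)]
  simp [Finsupp.sum]

theorem continuous_character (n : ℕ+) : Continuous fun χ : Polytorus => character χ n := by
  unfold character
  generalize PNat.factorMultiset n = m
  induction m using Multiset.induction with
  | empty =>
    have : (fun χ : Polytorus => (Multiset.map χ (0 : Multiset Nat.Primes)).prod) = fun _ => 1 := by
      funext χ; simp
    exact this ▸ continuous_const
  | cons a m ih =>
    have : (fun χ : Polytorus => (Multiset.map χ (a ::ₘ m : Multiset Nat.Primes)).prod) =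
        fun χ => χ a * (Multiset.map χ (m : Multiset Nat.Primes)).prod := by
      funext χ; simp
    exact this ▸ (continuous_apply a).mul ih

theorem continuous_shift_bohr (P : DirichletPoly) :
    Continuous fun x : ℝ≥0 × Polytorus => (P.shift x.1).bohr x.2 := by
  have : (fun x : ℝ≥0 × Polytorus => (P.shift x.1).bohr x.2) = fun x => ∑ n ∈ P.support,
      P n * ((n : ℕ) : ℂ) ^ (-((x.1 : ℝ) : ℂ)) * (character x.2 n : ℂ) := by
    funext x
    unfold DirichletPoly.bohr DirichletPoly.shift
    rw [Finsupp.onFinset_sum _ (by simp)]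
  rw [this]
  refine continuous_finsetSum _ fun n _ => ?_
  have hc : Continuous fun x : ℝ≥0 × Polytorus => (character x.2 n : ℂ) :=
    continuous_subtype_val.comp ((continuous_character n).comp continuous_snd)
  refine (continuous_const.mul (Continuous.const_cpow ?_ ?_)).mul hc
  · exact (Complex.continuous_ofReal.comp (NNReal.continuous_coe.comp continuous_fst)).neg
  · left
    exact_mod_cast n.ne_zero

theorem continuous_bohr (P : DirichletPoly) : Continuous P.bohr := by
  unfold DirichletPoly.bohr
  refine continuous_finsetSum _ fun n _ => continuous_const.mul ?_
  exact continuous_subtype_val.comp (continuous_character n)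

/-- Minkowski's inequality for bounded measurable functions on a probability space. -/
theorem minkowski {α E : Type*} [MeasurableSpace α] [NormedAddCommGroup E] (ν : Measure α)
    [IsFiniteMeasure ν] {p : ℝ} (hp : 1 ≤ p) {f g h : α → E} {C D : ℝ}
    (hf : AEStronglyMeasurable f ν) (hg : AEStronglyMeasurable g ν)
    (hh : AEStronglyMeasurable h ν)
    (hfC : ∀ x, ‖f x‖ ≤ C) (hgD : ∀ x, ‖g x‖ ≤ D) (hle : ∀ x, ‖h x‖ ≤ ‖f x‖ + ‖g x‖) :
    (∫ x, ‖h x‖ ^ p ∂ν) ^ (1 / p) ≤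
      (∫ x, ‖f x‖ ^ p ∂ν) ^ (1 / p) + (∫ x, ‖g x‖ ^ p ∂ν) ^ (1 / p) := by
  have h0 : 0 < p := by linarith
  have hq0 : ENNReal.ofReal p ≠ 0 := by simpa using h0
  have hqt : ENNReal.ofReal p ≠ ∞ := ENNReal.ofReal_ne_top
  have hq1 : 1 ≤ ENNReal.ofReal p := by simpa using hp
  have hqr : (ENNReal.ofReal p).toReal = p := ENNReal.toReal_ofReal h0.le
  have mf : MemLp f (ENNReal.ofReal p) ν := .of_bound hf C (.of_forall hfC)
  have mg : MemLp g (ENNReal.ofReal p) ν := .of_bound hg D (.of_forall hgD)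
  have mh : MemLp h (ENNReal.ofReal p) ν := .of_bound hh (C + D)
    (.of_forall fun x => (hle x).trans (add_le_add (hfC x) (hgD x)))
  have key : ∀ {u : α → E}, MemLp u (ENNReal.ofReal p) ν →
      (∫ x, ‖u x‖ ^ p ∂ν) ^ (1 / p) = (eLpNorm u (ENNReal.ofReal p) ν).toReal := by
    intro u hu
    rw [hu.eLpNorm_eq_integral_rpow_norm hq0 hqt, hqr, ENNReal.toReal_ofReal, one_div]
    exact Real.rpow_nonneg (integral_nonneg fun x => Real.rpow_nonneg (norm_nonneg _) _) _
  rw [key mf, key mg, key mh, ← ENNReal.toReal_add mf.eLpNorm_ne_top mg.eLpNorm_ne_top]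
  refine ENNReal.toReal_mono (ENNReal.add_ne_top.2 ⟨mf.eLpNorm_ne_top, mg.eLpNorm_ne_top⟩) ?_
  calc eLpNorm h (ENNReal.ofReal p) ν
      ≤ eLpNorm ((fun x => ‖f x‖) + fun x => ‖g x‖) (ENNReal.ofReal p) ν :=
        eLpNorm_mono_real hle
    _ ≤ _ := eLpNorm_add_le hf.norm hg.norm hq1
    _ = _ := by rw [eLpNorm_norm, eLpNorm_norm]

theorem polyHardyNorm_nonneg (p : ℝ) (P : DirichletPoly) : 0 ≤ polyHardyNorm p P :=
  Real.rpow_nonneg (integral_nonneg fun _ => Real.rpow_nonneg (norm_nonneg _) _) _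

theorem polyHardyNorm_add_le {p : ℝ} (hp : 1 ≤ p) (P Q : DirichletPoly) :
    polyHardyNorm p (P + Q) ≤ polyHardyNorm p P + polyHardyNorm p Q := by
  have bdd : ∀ R : DirichletPoly, ∃ C, ∀ χ, ‖R.bohr χ‖ ≤ C := fun R => by
    obtain ⟨C, hC⟩ := (isCompact_range (continuous_bohr R)).isBounded.exists_norm_le
    exact ⟨C, fun χ => hC _ ⟨χ, rfl⟩⟩
  obtain ⟨C, hC⟩ := bdd P
  obtain ⟨D, hD⟩ := bdd Q
  refine minkowski haar hp (continuous_bohr P).aestronglyMeasurable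
    (continuous_bohr Q).aestronglyMeasurable (continuous_bohr _).aestronglyMeasurable hC hD ?_
  intro χ
  rw [DirichletPoly.bohr_add]
  exact norm_add_le _ _

theorem norm_shift_bohr_le (P : DirichletPoly) (σ : ℝ≥0) (χ : Polytorus) :
    ‖(P.shift σ).bohr χ‖ ≤ ∑ n ∈ P.support, ‖P n‖ := by
  unfold DirichletPoly.bohr DirichletPoly.shift
  rw [Finsupp.onFinset_sum _ (by simp)]
  refine (norm_sum_le _ _).trans (Finset.sum_le_sum fun n _ => ?_)
  rw [norm_mul, norm_mul, Circle.norm_coe, mul_one]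
  refine mul_le_of_le_one_right (norm_nonneg _) ?_
  rw [Complex.norm_natCast_cpow_of_pos n.pos]
  refine Real.rpow_le_one_of_one_le_of_nonpos (by exact_mod_cast n.pos) ?_
  simp

theorem polyHardyNorm_shift_le {p : ℝ} (hp : 1 ≤ p) (P : DirichletPoly) (σ : ℝ≥0) :
    polyHardyNorm p (P.shift σ) ≤ ∑ n ∈ P.support, ‖P n‖ := by
  have h0 : 0 < p := by linarith
  have hC : 0 ≤ ∑ n ∈ P.support, ‖P n‖ := Finset.sum_nonneg fun _ _ => norm_nonneg _
  have : ∫ χ, ‖(P.shift σ).bohr χ‖ ^ p ∂haar ≤ (∑ n ∈ P.support, ‖P n‖) ^ p := by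
    calc _ ≤ ∫ _, (∑ n ∈ P.support, ‖P n‖) ^ p ∂haar :=
          integral_mono_of_nonneg (.of_forall fun _ => Real.rpow_nonneg (norm_nonneg _) _)
            (integrable_const _) (.of_forall fun χ => Real.rpow_le_rpow (norm_nonneg _)
              (norm_shift_bohr_le P σ χ) h0.le)
      _ = _ := by simp
  calc polyHardyNorm p (P.shift σ) ≤ ((∑ n ∈ P.support, ‖P n‖) ^ p) ^ (1 / p) :=
        Real.rpow_le_rpow (integral_nonneg fun _ => Real.rpow_nonneg (norm_nonneg _) _) this
          (by positivity)
    _ = _ := by rw [← Real.rpow_mul hC, mul_one_div_cancel h0.ne', Real.rpow_one]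

theorem measurable_polyHardyNorm_shift {p : ℝ} (hp : 1 ≤ p) (P : DirichletPoly) :
    Measurable fun σ : ℝ≥0 => polyHardyNorm p (P.shift σ) := by
  have hc : Continuous fun x : ℝ≥0 × Polytorus => ‖(P.shift x.1).bohr x.2‖ ^ p :=
    (continuous_shift_bohr P).norm.rpow_const fun _ => Or.inr (by linarith)
  exact (hc.stronglyMeasurable.integral_prod_right' (ν := haar)).measurable.pow_const _

theorem polyBergmanNorm_add_le {p : ℝ} (hp : 1 ≤ p) (μ : Measure ℝ≥0) [IsProbabilityMeasure μ]
    (P Q : DirichletPoly) :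
    polyBergmanNorm p μ (P + Q) ≤ polyBergmanNorm p μ P + polyBergmanNorm p μ Q := by
  have nrm : ∀ R : DirichletPoly, ∀ σ : ℝ≥0,
      ‖polyHardyNorm p (R.shift σ)‖ = polyHardyNorm p (R.shift σ) :=
    fun R σ => Real.norm_of_nonneg (polyHardyNorm_nonneg _ _)
  have := minkowski μ hp (f := fun σ => polyHardyNorm p (P.shift σ))
    (g := fun σ => polyHardyNorm p (Q.shift σ)) (h := fun σ => polyHardyNorm p ((P + Q).shift σ))
    (measurable_polyHardyNorm_shift hp P).aestronglyMeasurable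
    (measurable_polyHardyNorm_shift hp Q).aestronglyMeasurable
    (measurable_polyHardyNorm_shift hp (P + Q)).aestronglyMeasurable
    (fun σ => (nrm P σ).trans_le (polyHardyNorm_shift_le hp P σ))
    (fun σ => (nrm Q σ).trans_le (polyHardyNorm_shift_le hp Q σ))
    (fun σ => by
      rw [nrm, nrm, nrm, DirichletPoly.shift_add]
      exact polyHardyNorm_add_le hp _ _)
  simp only [nrm] at this
  exact this

/-! ### The Hardy and Bergman spaces as completions -/

/-- Dirichlet polynomials with the norm of `𝓗^p`. -/
def HardyPoly (_p : ℝ) : Type := DirichletPoly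

/-- Dirichlet polynomials with the norm of `𝓐^p_μ`. -/
def BergmanPoly (_p : ℝ) (_μ : Measure ℝ≥0) : Type := DirichletPoly

/-- The Dirichlet polynomial underlying an element of `HardyPoly p`. -/
def HardyPoly.poly {p : ℝ} (P : HardyPoly p) : DirichletPoly := P

/-- The Dirichlet polynomial underlying an element of `BergmanPoly p μ`. -/
def BergmanPoly.poly {p : ℝ} {μ : Measure ℝ≥0} (P : BergmanPoly p μ) : DirichletPoly := P

instance (p : ℝ) : AddCommGroup (HardyPoly p) := inferInstanceAs (AddCommGroup DirichletPoly)

instance (p : ℝ) (μ : Measure ℝ≥0) : AddCommGroup (BergmanPoly p μ) :=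
  inferInstanceAs (AddCommGroup DirichletPoly)

theorem polyHardyNorm_zero {p : ℝ} (hp : 1 ≤ p) : polyHardyNorm p 0 = 0 := by
  have h0 : p ≠ 0 := by linarith
  simp [polyHardyNorm, DirichletPoly.bohr, Real.zero_rpow h0, Real.zero_rpow (inv_ne_zero h0)]

theorem polyHardyNorm_neg (p : ℝ) (P : DirichletPoly) :
    polyHardyNorm p (-P) = polyHardyNorm p P := by
  simp [polyHardyNorm, DirichletPoly.bohr_neg]

theorem polyBergmanNorm_zero {p : ℝ} (hp : 1 ≤ p) (μ : Measure ℝ≥0) :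
    polyBergmanNorm p μ 0 = 0 := by
  have h0 : p ≠ 0 := by linarith
  simp [polyBergmanNorm, DirichletPoly.shift_zero_poly, polyHardyNorm_zero hp,
    Real.zero_rpow h0, Real.zero_rpow (inv_ne_zero h0)]

theorem polyBergmanNorm_neg (p : ℝ) (μ : Measure ℝ≥0) (P : DirichletPoly) :
    polyBergmanNorm p μ (-P) = polyBergmanNorm p μ P := by
  simp [polyBergmanNorm, DirichletPoly.shift_neg, polyHardyNorm_neg]

instance (p : ℝ) [hp : Fact (1 ≤ p)] : SeminormedAddCommGroup (HardyPoly p) :=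
  AddGroupSeminorm.toSeminormedAddCommGroup
    { toFun := polyHardyNorm p
      map_zero' := polyHardyNorm_zero hp.out
      add_le' := polyHardyNorm_add_le hp.out
      neg' := polyHardyNorm_neg p }

instance (p : ℝ) [hp : Fact (1 ≤ p)] (μ : Measure ℝ≥0) [IsProbabilityMeasure μ] :
    SeminormedAddCommGroup (BergmanPoly p μ) :=
  AddGroupSeminorm.toSeminormedAddCommGroup
    { toFun := polyBergmanNorm p μ
      map_zero' := polyBergmanNorm_zero hp.out μ
      add_le' := polyBergmanNorm_add_le hp.out μ
      neg' := polyBergmanNorm_neg p μ }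

/-- The completion of the Dirichlet polynomials for the norm of `𝓗^p`. -/
abbrev HardyCompletion (p : ℝ) [Fact (1 ≤ p)] : Type := UniformSpace.Completion (HardyPoly p)

/-- The completion of the Dirichlet polynomials for the norm of `𝓐^p_μ`. -/
abbrev BergmanCompletion (p : ℝ) [Fact (1 ≤ p)] (μ : Measure ℝ≥0) [IsProbabilityMeasure μ] :
    Type :=
  UniformSpace.Completion (BergmanPoly p μ)

/-! ### Realization as spaces of functions on the half-plane `Re s > 1/2` -/

/-- The half-plane `ℂ_{1/2}`. -/
abbrev HalfPlane : Type := {s : ℂ // 1 / 2 < s.re}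

/-- The function on `ℂ_{1/2}` defined by an element of the completion: its value at `s` is the
continuous extension to the completion of the point evaluation `P ↦ P(s)`. -/
def HardyCompletion.toFun {p : ℝ} [Fact (1 ≤ p)] (F : HardyCompletion p) : HalfPlane → ℂ :=
  fun s => UniformSpace.Completion.extension
    (fun P : HardyPoly p => P.poly.eval (s : ℂ)) F

/-- The function on `ℂ_{1/2}` defined by an element of the completion: its value at `s` is the
continuous extension to the completion of the point evaluation `P ↦ P(s)`. -/
def BergmanCompletion.toFun {p : ℝ} [Fact (1 ≤ p)] {μ : Measure ℝ≥0} [IsProbabilityMeasure μ]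
    (F : BergmanCompletion p μ) : HalfPlane → ℂ :=
  fun s => UniformSpace.Completion.extension
    (fun P : BergmanPoly p μ => P.poly.eval (s : ℂ)) F

/-- `𝓗^p` as a set of functions on `ℂ_{1/2}`. -/
def hardySpace (p : ℝ) [Fact (1 ≤ p)] : Set (HalfPlane → ℂ) :=
  Set.range (HardyCompletion.toFun (p := p))

/-- `𝓐^p_μ` as a set of functions on `ℂ_{1/2}`. -/
def bergmanSpace (p : ℝ) [Fact (1 ≤ p)] (μ : Measure ℝ≥0) [IsProbabilityMeasure μ] :
    Set (HalfPlane → ℂ) :=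
  Set.range (BergmanCompletion.toFun (p := p) (μ := μ))

/-- The norm of `f ∈ 𝓗^p`: the norm of the element of the completion that defines `f` (this
element is unique, so that the infimum is over one number). -/
def hardyNorm (p : ℝ) [Fact (1 ≤ p)] (f : HalfPlane → ℂ) : ℝ :=
  sInf {r : ℝ | ∃ F : HardyCompletion p, HardyCompletion.toFun F = f ∧ r = ‖F‖}

/-- The norm of `f ∈ 𝓐^p_μ`: the norm of the element of the completion that defines `f` (this
element is unique if `0` is in the support of `μ`, so that the infimum is over one number). -/
def bergmanNorm (p : ℝ) [Fact (1 ≤ p)] (μ : Measure ℝ≥0) [IsProbabilityMeasure μ]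
    (f : HalfPlane → ℂ) : ℝ :=
  sInf {r : ℝ | ∃ F : BergmanCompletion p μ, BergmanCompletion.toFun F = f ∧ r = ‖F‖}

/-- The translate `f_σ(s) = f(s + σ)`. -/
def horizontalTranslate (σ : ℝ≥0) (f : HalfPlane → ℂ) : HalfPlane → ℂ :=
  fun s => f ⟨(s : ℂ) + ((σ : ℝ) : ℂ), by
    have h1 := s.2
    have h2 := σ.2
    simp only [Complex.add_re, Complex.ofReal_re]
    linarith⟩

end DirichletSeries

end

open DirichletSeries

noncomputable section

namespace DirichletSeries

/-! ### Characters of the polytorus -/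

/-! On polynomials, every assertion reduces to the fact that `P ↦ P_σ` is a contraction of 𝓗^p. The
multiplier `n^(-σ) = exp(-σ |log n|)` is the characteristic function of a Cauchy law at `-log n`, so
the Bohr lift of `P_σ` is an average of translates of the lift of `P` along the flow `(q^(-it))_q`.
Jensen's inequality and the invariance of Haar measure give `‖P_σ‖ ≤ ‖P‖`
(`polyHardyNorm_mulCoeff_le`, `polyHardyNorm_shift_le_self`). Since `μ` is a probability measure,
the Bergman norm is at most the Hardy norm. Translation is also a contraction for the Bergman norm
and tends to the identity on polynomials as `c → 0`, hence on the completion; this gives (iii). For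
(ii), dominated convergence carries the integral formula from polynomials to 𝓗^p
(`norm_hardyToBergman`).

The harder point is that elements of the completions are functions. Point evaluations are bounded on
𝓗^1 by integration against a unimodular reproducing kernel (`norm_eval_le_integral`). Since `0` is
in the support of `μ`, small shifts carry positive mass, and the bound passes to 𝓐^p_μ. For
injectivity, an element with zero function has zero limit coefficients by uniqueness of Dirichlet
series. Multiplying the coefficients by `exp(-v (log n)^2 / 2)`, a Gaussian characteristic function
and thus a contraction, makes them summable, so the regularized element is zero; then `v → 0`
(`PolyModel.eq_zero_of_forall_eval_eq_zero`). `PolyModel` collects what this argument needs, so that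
it serves both norms. -/

instance : haar.IsHaarMeasure := inferInstanceAs (Measure.haarMeasure ⊤).IsHaarMeasure

theorem integral_haar_mul_left {E : Type*} [NormedAddCommGroup E] [NormedSpace ℝ E]
    (f : Polytorus → E) (ψ : Polytorus) : ∫ χ, f (ψ * χ) ∂haar = ∫ χ, f χ ∂haar :=
  integral_mul_left_eq_self f ψ

theorem integrable_haar_of_continuous {E : Type*} [NormedAddCommGroup E] {f : Polytorus → E}
    (hf : Continuous f) : Integrable f haar :=
  hf.integrable_of_hasCompactSupport (HasCompactSupport.of_compactSpace f)

theorem character_mul (χ ψ : Polytorus) (n : ℕ+) :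
    character (χ * ψ) n = character χ n * character ψ n := by
  exact Multiset.prod_map_mul

theorem prod_map_factorMultiset {M : Type*} [CommMonoid M] (g : ℕ+ →* M) (n : ℕ+) :
    (Multiset.map (fun q : Nat.Primes => g (q : ℕ+)) (PNat.factorMultiset n)).prod = g n := by
  conv_rhs => rw [← PNat.prod_factorMultiset n]
  refine Eq.trans ?_ (map_multiset_prod g _).symm
  exact (congrArg Multiset.prod (Multiset.map_map g (fun q : Nat.Primes => (q : ℕ+))
    (PNat.factorMultiset n))).symm

/-- The completely multiplicative function `n ↦ n^(-s)`. -/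
def cpowHom (s : ℂ) : ℕ+ →* ℂ where
  toFun n := ((n : ℕ) : ℂ) ^ (-s)
  map_one' := by simp
  map_mul' m n := by
    rw [PNat.mul_coe, Nat.cast_mul, Complex.natCast_mul_natCast_cpow]

theorem coe_character (χ : Polytorus) (n : ℕ+) : (character χ n : ℂ) =
    (Multiset.map (fun q => (χ q : ℂ)) (PNat.factorMultiset n)).prod := by
  exact (map_multiset_prod Circle.coeHom (Multiset.map χ (PNat.factorMultiset n))).trans
    (congrArg Multiset.prod (Multiset.map_map Circle.coeHom χ (PNat.factorMultiset n)))

theorem prod_map_eq_prod_pow_count {M : Type*} [CommMonoid M] (f : Nat.Primes → M)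
    (v : Multiset Nat.Primes) {S : Finset Nat.Primes} (hS : v.toFinset ⊆ S) :
    (Multiset.map f v).prod = ∏ q ∈ S, f q ^ v.count q := by
  rw [Finset.prod_multiset_map_count]
  refine Finset.prod_subset hS fun q _ hq => ?_
  rw [Multiset.count_eq_zero_of_notMem (by simpa using hq), pow_zero]

/-- The point `(q^(-it))_q` of the polytorus. -/
def verticalFlow (t : ℝ) : Polytorus := fun q => Circle.exp (-(t * Real.log q))

theorem natCast_cpow_eq_exp {n : ℕ} (hn : n ≠ 0) (s : ℂ) :
    (n : ℂ) ^ s = Complex.exp ((Real.log n : ℝ) * s) := by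
  rw [Complex.cpow_def_of_ne_zero (by exact_mod_cast hn), Complex.natCast_log]

/-- Translation by the flow therefore multiplies the `n`-th coefficient by `n^(-it)`: it is the Bohr
lift of a vertical translation. -/
theorem character_verticalFlow (t : ℝ) (n : ℕ+) :
    (character (verticalFlow t) n : ℂ) = Complex.exp (((-Real.log n : ℝ) * t : ℂ) * Complex.I) := by
  rw [coe_character]
  have h : ∀ k : ℕ+, cpowHom (t * Complex.I) k =
      Complex.exp (((-Real.log k : ℝ) * t : ℂ) * Complex.I) := by
    intro k
    change ((k : ℕ) : ℂ) ^ (-(t * Complex.I)) = _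
    rw [natCast_cpow_eq_exp k.ne_zero]
    congr 1
    push_cast
    ring
  rw [← h, ← prod_map_factorMultiset]
  congr 2
  funext q
  rw [h]
  simp only [verticalFlow, Circle.coe_exp]
  congr 1
  push_cast
  simp
  ring

theorem continuous_verticalFlow : Continuous verticalFlow := by
  unfold verticalFlow
  fun_prop

/-! ### Coefficients of a Dirichlet polynomial -/

theorem integral_character_mul_conj {m n : ℕ+} (hmn : m ≠ n) :
    ∫ χ, (character χ m : ℂ) * ((character χ n)⁻¹ : Circle) ∂haar = 0 := by
  have hlog : Real.log m - Real.log n ≠ 0 := by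
    rw [sub_ne_zero]
    intro h
    refine hmn (PNat.coe_injective ?_)
    exact_mod_cast Real.log_injOn_pos (by simp : (0 : ℝ) < m) (by simp : (0 : ℝ) < n) h
  -- With this `t`, translation by the flow multiplies the integrand by `exp(-iπ) = -1`, so the
  -- integral equals its own negative.
  set t : ℝ := Real.pi / (Real.log m - Real.log n)
  have h := integral_haar_mul_left
    (fun χ => (character χ m : ℂ) * ((character χ n)⁻¹ : Circle)) (verticalFlow t)
  have key : (character (verticalFlow t) m : ℂ) * ((character (verticalFlow t) n)⁻¹ : Circle) =
      -1 := by
    rw [Circle.coe_inv, character_verticalFlow, character_verticalFlow, ← Complex.exp_neg,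
      ← Complex.exp_add]
    have : ((-Real.log m : ℝ) * t : ℂ) * Complex.I + -(((-Real.log n : ℝ) * t : ℂ) * Complex.I) =
        -((((Real.log m - Real.log n) * t : ℝ) : ℂ) * Complex.I) := by
      push_cast; ring
    rw [this, mul_div_cancel₀ _ hlog, Complex.exp_neg, Complex.exp_pi_mul_I]
    norm_num
  have h2 : ∀ χ, (character (verticalFlow t * χ) m : ℂ) *
      ((character (verticalFlow t * χ) n)⁻¹ : Circle) =
      -((character χ m : ℂ) * ((character χ n)⁻¹ : Circle)) := by
    intro χ
    rw [character_mul, character_mul, mul_inv, Circle.coe_mul, Circle.coe_mul, mul_mul_mul_comm,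
      key, neg_one_mul]
  simp only [h2, integral_neg] at h
  exact CharZero.neg_eq_self_iff.mp h

/-- The coefficient is the Fourier coefficient of the lift at the character of `n`, by
orthogonality. -/
theorem norm_coeff_le_integral (P : DirichletPoly) (n : ℕ+) :
    ‖P n‖ ≤ ∫ χ, ‖P.bohr χ‖ ∂haar := by
  have hc : ∀ k, Continuous fun χ : Polytorus => (character χ k : ℂ) :=
    fun k => continuous_subtype_val.comp (continuous_character k)
  have hci : ∀ k, Continuous fun χ : Polytorus => (((character χ k)⁻¹ : Circle) : ℂ) :=
    fun k => continuous_subtype_val.comp (continuous_character k).inv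
  have h : ∫ χ, P.bohr χ * ((character χ n)⁻¹ : Circle) ∂haar = P n := by
    simp only [DirichletPoly.bohr, Finsupp.sum, Finset.sum_mul, mul_assoc]
    rw [integral_finsetSum (f := fun k χ => P k * ((character χ k : ℂ) *
      ((character χ n)⁻¹ : Circle))) _ fun k _ => integrable_haar_of_continuous
      (continuous_const.mul ((hc k).mul (hci n)))]
    simp only [integral_const_mul]
    rw [Finset.sum_eq_single n]
    · simp
    · intro k _ hk
      rw [integral_character_mul_conj hk, mul_zero]
    · intro hn
      simp [Finsupp.notMem_support_iff.mp hn]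
  rw [← h]
  refine (norm_integral_le_integral_norm _).trans_eq (integral_congr_ae (.of_forall fun χ => ?_))
  simp only
  rw [norm_mul, Circle.norm_coe, mul_one]

/-! ### Point evaluations -/

/-! ### The reproducing kernel in one prime coordinate. -/

section Kernel

variable {q : Nat.Primes} {h : Polytorus → ℂ}

/-- Rotating the coordinate `q` by `exp(iπ/k)` fixes `h` and changes the sign of `χ_q^k`. -/
theorem integral_mul_zpow_eq_zero
    (hinv : ∀ (w : Circle) (χ : Polytorus), h (Pi.mulSingle q w * χ) = h χ) {k : ℤ} (hk : k ≠ 0) :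
    ∫ χ, h χ * (χ q : ℂ) ^ k ∂haar = 0 := by
  have hk' : (k : ℝ) ≠ 0 := by exact_mod_cast hk
  have h1 := integral_haar_mul_left (fun χ => h χ * (χ q : ℂ) ^ k)
    (Pi.mulSingle q (Circle.exp (Real.pi / k)))
  have key : ((Circle.exp (Real.pi / k) : Circle) : ℂ) ^ k = -1 := by
    rw [Circle.coe_exp, ← Complex.exp_int_mul, ← Complex.exp_pi_mul_I]
    congr 1
    have : (k : ℂ) ≠ 0 := by exact_mod_cast hk
    push_cast
    field_simp
  simp only [hinv, Pi.mul_apply, Pi.mulSingle_eq_same, Circle.coe_mul, mul_zpow, key] at h1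
  have h2 : ∀ χ : Polytorus, h χ * (-1 * (χ q : ℂ) ^ k) = -(h χ * (χ q : ℂ) ^ k) := by
    intro χ; ring
  simp only [h2, integral_neg] at h1
  exact CharZero.neg_eq_self_iff.mp h1

theorem one_sub_mul_inv_ne_zero {z : ℂ} (hz : ‖z‖ < 1) (w : Circle) : 1 - z * (w : ℂ)⁻¹ ≠ 0 := by
  intro h0
  have : ‖z * (w : ℂ)⁻¹‖ = 1 := by rw [← sub_eq_zero.mp h0, norm_one]
  rw [norm_mul, norm_inv, Circle.norm_coe, inv_one, mul_one] at this
  exact hz.ne this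

/-- Formally, expand `1/(1 - z w̄)` in powers of `z w̄`; only the term of order `e` survives
integration. In place of the series, the identity `w^k/(1 - z w̄) = z w^(k-1)/(1 - z w̄) + w^k`
gives a recursion in `k`, with initial value fixed by boundedness. -/
theorem integral_mul_zpow_div (hh : Continuous h)
    (hinv : ∀ (w : Circle) (χ : Polytorus), h (Pi.mulSingle q w * χ) = h χ) {z : ℂ} (hz : ‖z‖ < 1)
    (e : ℕ) :
    ∫ χ, h χ * ((χ q : ℂ) ^ (e : ℤ) / (1 - z * (χ q : ℂ)⁻¹)) ∂haar = z ^ e * ∫ χ, h χ ∂haar := by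
  have hq : Continuous fun χ : Polytorus => (χ q : ℂ) :=
    continuous_subtype_val.comp (continuous_apply q)
  have hq0 : ∀ χ : Polytorus, (χ q : ℂ) ≠ 0 := fun χ => Circle.coe_ne_zero _
  have hd : ∀ χ : Polytorus, 1 - z * (χ q : ℂ)⁻¹ ≠ 0 := fun χ => one_sub_mul_inv_ne_zero hz _
  have hz' : ∀ k : ℤ, Continuous fun χ : Polytorus => (χ q : ℂ) ^ k :=
    fun k => hq.zpow₀ k fun χ => Or.inl (hq0 χ)
  have hdc : Continuous fun χ : Polytorus => 1 - z * (χ q : ℂ)⁻¹ :=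
    continuous_const.sub (continuous_const.mul (hq.inv₀ hq0))
  have hJc : ∀ k : ℤ, Continuous fun χ : Polytorus =>
      h χ * ((χ q : ℂ) ^ k / (1 - z * (χ q : ℂ)⁻¹)) :=
    fun k => hh.mul ((hz' k).div hdc hd)
  set J : ℤ → ℂ := fun k => ∫ χ, h χ * ((χ q : ℂ) ^ k / (1 - z * (χ q : ℂ)⁻¹)) ∂haar with hJ
  have hrec : ∀ k, J k = z * J (k - 1) + ∫ χ, h χ * (χ q : ℂ) ^ k ∂haar := by
    intro k
    simp only [hJ]
    rw [← integral_const_mul, ← integral_add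
      (f := fun χ => z * (h χ * ((χ q : ℂ) ^ (k - 1) / (1 - z * (χ q : ℂ)⁻¹))))
      (g := fun χ => h χ * (χ q : ℂ) ^ k)
      (integrable_haar_of_continuous (continuous_const.mul (hJc _)))
      (integrable_haar_of_continuous (hh.mul (hz' k)))]
    refine integral_congr_ae (.of_forall fun χ => ?_)
    have h1 := hq0 χ
    have h2 := hd χ
    simp only
    rw [zpow_sub_one₀ h1]
    generalize (χ q : ℂ) ^ k = a
    generalize (χ q : ℂ)⁻¹ = b at h2 ⊢
    field_simp
    ring
  -- Going down from `-1`, the exponent `0` is never met, so the recursion has no inhomogeneous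
  -- term. As `J` is bounded and `|z| < 1`, this forces `J (-1) = 0`.
  have hneg : ∀ m : ℕ, J (-1) = z ^ m * J (-1 - m) := by
    intro m
    induction m with
    | zero => simp
    | succ m ih =>
      rw [ih, hrec (-1 - m), integral_mul_zpow_eq_zero hinv (by omega), pow_succ, add_zero,
        mul_assoc]
      congr 3
      push_cast
      ring
  obtain ⟨M, hM⟩ : ∃ M, ∀ χ, ‖h χ * ((1 : ℂ) / (1 - z * (χ q : ℂ)⁻¹))‖ ≤ M := by
    obtain ⟨M, hM⟩ := (isCompact_range (hh.mul
      (continuous_const.div hdc hd : Continuous fun χ : Polytorus =>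
        (1 : ℂ) / (1 - z * (χ q : ℂ)⁻¹)))).isBounded.exists_norm_le
    exact ⟨M, fun χ => hM _ ⟨χ, rfl⟩⟩
  have hJM : ∀ k, ‖J k‖ ≤ M := by
    intro k
    refine (norm_integral_le_of_norm_le_const (C := M) (.of_forall fun χ => ?_)).trans_eq (by simp)
    have : ‖h χ * ((χ q : ℂ) ^ k / (1 - z * (χ q : ℂ)⁻¹))‖ =
        ‖h χ * ((1 : ℂ) / (1 - z * (χ q : ℂ)⁻¹))‖ := by
      rw [norm_mul, norm_mul, norm_div, norm_div, norm_zpow, Circle.norm_coe, one_zpow, norm_one]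
    rw [this]
    exact hM χ
  have h1 : J (-1) = 0 := by
    have ht : Tendsto (fun m : ℕ => ‖z‖ ^ m * M) atTop (𝓝 (0 * M)) :=
      (tendsto_pow_atTop_nhds_zero_of_lt_one (norm_nonneg z) hz).mul_const M
    rw [zero_mul] at ht
    rw [← norm_le_zero_iff]
    refine ge_of_tendsto ht (.of_forall fun m => ?_)
    rw [hneg m, norm_mul, norm_pow]
    exact mul_le_mul_of_nonneg_left (hJM _) (by positivity)
  have h0 : J 0 = ∫ χ, h χ ∂haar := by
    rw [hrec 0, zero_sub, h1]
    simp
  change J e = _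
  induction e with
  | zero => simpa using h0
  | succ e ih =>
    rw [hrec, integral_mul_zpow_eq_zero hinv (by omega), add_zero, pow_succ']
    push_cast
    rw [add_sub_cancel_right, ih, mul_assoc]

/-- The unimodular factor `(1 - z̄ w) / (1 - z w̄)` of the kernel of the point evaluations. -/
def kernelFactor (z : ℂ) (w : Circle) : ℂ :=
  (1 - (starRingEnd ℂ) z * w) / (1 - z * (w : ℂ)⁻¹)

theorem continuous_kernelFactor {z : ℂ} (hz : ‖z‖ < 1) : Continuous (kernelFactor z) := by
  unfold kernelFactor
  have hc : Continuous fun w : Circle => (w : ℂ) := continuous_subtype_val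
  exact (continuous_const.sub (continuous_const.mul hc)).div
    (continuous_const.sub (continuous_const.mul (hc.inv₀ fun w => Circle.coe_ne_zero w)))
    (one_sub_mul_inv_ne_zero hz)

/-- The numerator is the conjugate of the denominator. The inequality also covers a vanishing
denominator, where the quotient is `0`. -/
theorem norm_kernelFactor_le (z : ℂ) (w : Circle) : ‖kernelFactor z w‖ ≤ 1 := by
  have : 1 - (starRingEnd ℂ) z * w = (starRingEnd ℂ) (1 - z * (w : ℂ)⁻¹) := by
    rw [← Circle.coe_inv, Circle.coe_inv_eq_conj]
    simp
  rw [kernelFactor, norm_div, this, RCLike.norm_conj]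
  exact div_self_le_one _

/-- The two terms of the numerator contribute `z^e` and `-z̄ z^(e+1)`. Thus a weight of modulus at
most one reproduces the value at `z`, up to the factor `1 - |z|^2`. -/
theorem integral_mul_pow_mul_kernelFactor (hh : Continuous h)
    (hinv : ∀ (w : Circle) (χ : Polytorus), h (Pi.mulSingle q w * χ) = h χ) {z : ℂ} (hz : ‖z‖ < 1)
    (e : ℕ) :
    ∫ χ, h χ * ((χ q : ℂ) ^ e * kernelFactor z (χ q)) ∂haar =
      z ^ e * (1 - ‖z‖ ^ 2 : ℝ) * ∫ χ, h χ ∂haar := by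
  have hq : Continuous fun χ : Polytorus => (χ q : ℂ) :=
    continuous_subtype_val.comp (continuous_apply q)
  have hq0 : ∀ χ : Polytorus, (χ q : ℂ) ≠ 0 := fun χ => Circle.coe_ne_zero _
  have hJc : ∀ k : ℤ, Continuous fun χ : Polytorus =>
      h χ * ((χ q : ℂ) ^ k / (1 - z * (χ q : ℂ)⁻¹)) :=
    fun k => hh.mul ((hq.zpow₀ k fun χ => Or.inl (hq0 χ)).div
      (continuous_const.sub (continuous_const.mul (hq.inv₀ hq0)))
      fun χ => one_sub_mul_inv_ne_zero hz _)
  have hsplit : ∀ χ : Polytorus, h χ * ((χ q : ℂ) ^ e * kernelFactor z (χ q)) =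
      h χ * ((χ q : ℂ) ^ (e : ℤ) / (1 - z * (χ q : ℂ)⁻¹)) - (starRingEnd ℂ) z *
        (h χ * ((χ q : ℂ) ^ ((e + 1 : ℕ) : ℤ) / (1 - z * (χ q : ℂ)⁻¹))) := by
    intro χ
    rw [kernelFactor, zpow_natCast, zpow_natCast, pow_succ]
    ring
  simp only [hsplit]
  rw [integral_sub (f := fun χ => h χ * ((χ q : ℂ) ^ (e : ℤ) / (1 - z * (χ q : ℂ)⁻¹)))
    (g := fun χ => (starRingEnd ℂ) z *
        (h χ * ((χ q : ℂ) ^ ((e + 1 : ℕ) : ℤ) / (1 - z * (χ q : ℂ)⁻¹))))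
    (integrable_haar_of_continuous (hJc _))
    (integrable_haar_of_continuous (continuous_const.mul (hJc _))), integral_const_mul,
    integral_mul_zpow_div hh hinv hz, integral_mul_zpow_div hh hinv hz]
  have : ((1 - ‖z‖ ^ 2 : ℝ) : ℂ) = 1 - (starRingEnd ℂ) z * z := by
    rw [Complex.conj_mul']
    push_cast
    rfl
  rw [this]
  ring

/-- Primes are added one at a time: the product over the others does not depend on the new
coordinate and plays the role of `h`, so no product decomposition of Haar measure is needed. -/
theorem integral_prod_pow_mul_kernelFactor (S : Finset Nat.Primes) (z : Nat.Primes → ℂ)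
    (hz : ∀ q, ‖z q‖ < 1) (e : Nat.Primes → ℕ) :
    ∫ χ, ∏ q ∈ S, ((χ q : ℂ) ^ e q * kernelFactor (z q) (χ q)) ∂haar =
      ∏ q ∈ S, (z q ^ e q * (1 - ‖z q‖ ^ 2 : ℝ)) := by
  induction S using Finset.induction with
  | empty => simp
  | insert a S ha ih =>
    have := integral_mul_pow_mul_kernelFactor (q := a)
      (h := fun χ => ∏ q ∈ S, ((χ q : ℂ) ^ e q * kernelFactor (z q) (χ q)))
      (continuous_finsetProd _ fun q _ =>
        ((continuous_subtype_val.comp (continuous_apply q)).pow _).mul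
          ((continuous_kernelFactor (hz q)).comp (continuous_apply q)))
      (fun w χ => Finset.prod_congr rfl fun q hq => by
        have : q ≠ a := fun h => ha (h ▸ hq)
        simp [Pi.mulSingle_eq_of_ne this]) (hz a) (e a)
    rw [Finset.prod_insert ha, ← ih, ← this]
    refine integral_congr_ae (.of_forall fun χ => ?_)
    simp only
    rw [Finset.prod_insert ha, mul_comm]

end Kernel

theorem norm_natCast_cpow_neg (n : ℕ+) (s : ℂ) :
    ‖((n : ℕ) : ℂ) ^ (-s)‖ = ((n : ℕ) : ℝ) ^ (-s.re) := by
  rw [Complex.norm_natCast_cpow_of_pos n.pos, Complex.neg_re]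

/-- This bounds `∏ (1 - |z_q|^2)` below by the exponential of a convergent sum. -/
theorem exp_neg_two_mul_le {x : ℝ} (hx : x ≤ 1 / 2) (hx0 : 0 ≤ x) : Real.exp (-(2 * x)) ≤ 1 - x := by
  have h1 : 0 < 1 - x := by linarith
  have h2 : (1 - x)⁻¹ ≤ Real.exp (2 * x) := by
    refine le_trans ?_ (Real.add_one_le_exp _)
    rw [inv_le_iff_one_le_mul₀ h1]
    nlinarith
  rw [Real.exp_neg]
  exact inv_le_of_inv_le₀ h1 h2

/-- Point evaluations in the half-plane `Re s > 1/2` are bounded for the norm of `𝓗¹`, uniformly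
on vertical lines. -/
theorem norm_eval_le_integral (P : DirichletPoly) {s : ℂ} (hs : 1 / 2 < s.re) :
    ‖P.eval s‖ ≤ Real.exp (2 * ∑' q : Nat.Primes, (q : ℝ) ^ (-2 * s.re)) *
      ∫ χ, ‖P.bohr χ‖ ∂haar := by
  set z : Nat.Primes → ℂ := fun q => ((q : ℕ) : ℂ) ^ (-s) with hzdef
  have hzn : ∀ q, ‖z q‖ = (q : ℝ) ^ (-s.re) := fun q => norm_natCast_cpow_neg (q : ℕ+) s
  have hz2 : ∀ q, ‖z q‖ ^ 2 = (q : ℝ) ^ (-2 * s.re) := by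
    intro q
    rw [hzn, ← Real.rpow_natCast, ← Real.rpow_mul (by positivity)]
    congr 1
    push_cast
    ring
  have hhalf : ∀ q, ‖z q‖ ^ 2 ≤ 1 / 2 := by
    intro q
    rw [hz2]
    have h2 : (2 : ℝ) ≤ q := by exact_mod_cast q.2.two_le
    calc (q : ℝ) ^ (-2 * s.re) ≤ (q : ℝ) ^ (-1 : ℝ) :=
          Real.rpow_le_rpow_of_exponent_le (by linarith) (by linarith)
      _ = (q : ℝ)⁻¹ := Real.rpow_neg_one _
      _ ≤ 1 / 2 := by rw [one_div]; exact inv_anti₀ two_pos h2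
  have hz1 : ∀ q, ‖z q‖ < 1 := by
    intro q
    have := hhalf q
    nlinarith [norm_nonneg (z q)]
  -- The primes dividing some `n` in the support: the kernel is a finite product, and the dependence
  -- on `S` disappears in `hprod`.
  set S : Finset Nat.Primes := P.support.biUnion fun n => (PNat.factorMultiset n).toFinset
  have hS : ∀ n ∈ P.support, (PNat.factorMultiset n).toFinset ⊆ S :=
    fun n hn => Finset.subset_biUnion_of_mem (fun n : ℕ+ => (PNat.factorMultiset n).toFinset) hn
  set U : Polytorus → ℂ := fun χ => ∏ q ∈ S, kernelFactor (z q) (χ q)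
  have hUc : Continuous U := continuous_finsetProd _ fun q _ =>
    (continuous_kernelFactor (hz1 q)).comp (continuous_apply q)
  have hU1 : ∀ χ, ‖U χ‖ ≤ 1 := by
    intro χ
    rw [norm_prod]
    exact Finset.prod_le_one (fun _ _ => norm_nonneg _) fun q _ => norm_kernelFactor_le _ _
  have hterm : ∀ n ∈ P.support, ∫ χ, (character χ n : ℂ) * U χ ∂haar =
      ((n : ℕ) : ℂ) ^ (-s) * ∏ q ∈ S, ((1 - ‖z q‖ ^ 2 : ℝ) : ℂ) := by
    intro n hn
    have h1 := integral_prod_pow_mul_kernelFactor S z hz1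
      fun q => Multiset.count q (PNat.factorMultiset n)
    simp only [Finset.prod_mul_distrib] at h1
    have h2 : ∏ q ∈ S, z q ^ Multiset.count q (PNat.factorMultiset n) = ((n : ℕ) : ℂ) ^ (-s) := by
      rw [← prod_map_eq_prod_pow_count z _ (hS n hn)]
      exact prod_map_factorMultiset (cpowHom s) n
    rw [h2] at h1
    rw [← h1]
    refine integral_congr_ae (.of_forall fun χ => ?_)
    simp only
    rw [coe_character, prod_map_eq_prod_pow_count _ _ (hS n hn)]
  have hint : ∫ χ, P.bohr χ * U χ ∂haar = P.eval s * ∏ q ∈ S, ((1 - ‖z q‖ ^ 2 : ℝ) : ℂ) := by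
    simp only [DirichletPoly.bohr, DirichletPoly.eval, Finsupp.sum, Finset.sum_mul, mul_assoc]
    rw [integral_finsetSum (f := fun k χ => P k * ((character χ k : ℂ) * U χ)) _
      fun k _ => integrable_haar_of_continuous
      (continuous_const.mul ((continuous_subtype_val.comp (continuous_character k)).mul hUc))]
    refine Finset.sum_congr rfl fun n hn => ?_
    rw [integral_const_mul, hterm n hn]
  have hle : ‖P.eval s‖ * ∏ q ∈ S, (1 - ‖z q‖ ^ 2) ≤ ∫ χ, ‖P.bohr χ‖ ∂haar := by
    have h1 : ‖∫ χ, P.bohr χ * U χ ∂haar‖ ≤ ∫ χ, ‖P.bohr χ‖ ∂haar := by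
      refine norm_integral_le_of_norm_le (integrable_haar_of_continuous (continuous_bohr P).norm)
        (.of_forall fun χ => ?_)
      rw [norm_mul]
      exact mul_le_of_le_one_right (norm_nonneg _) (hU1 χ)
    rw [hint, norm_mul, norm_prod] at h1
    refine le_of_eq_of_le ?_ h1
    congr 1
    refine Finset.prod_congr rfl fun q _ => ?_
    rw [Complex.norm_real, Real.norm_of_nonneg]
    have := hhalf q
    linarith
  have hsum : Summable fun q : Nat.Primes => (q : ℝ) ^ (-2 * s.re) :=
    Nat.Primes.summable_rpow.2 (by linarith)
  have hprod : Real.exp (-(2 * ∑' q : Nat.Primes, (q : ℝ) ^ (-2 * s.re))) ≤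
      ∏ q ∈ S, (1 - ‖z q‖ ^ 2) := by
    calc _ ≤ Real.exp (∑ q ∈ S, -(2 * ‖z q‖ ^ 2)) := by
          rw [Real.exp_le_exp, Finset.sum_neg_distrib, ← Finset.mul_sum]
          simp only [hz2]
          have := hsum.sum_le_tsum S fun q _ => by positivity
          linarith
      _ = ∏ q ∈ S, Real.exp (-(2 * ‖z q‖ ^ 2)) := Real.exp_sum _ _
      _ ≤ _ := Finset.prod_le_prod (fun _ _ => (Real.exp_pos _).le)
          fun q _ => exp_neg_two_mul_le (hhalf q) (by positivity)
  have hfin := (mul_le_mul_of_nonneg_left hprod (norm_nonneg (P.eval s))).trans hle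
  rw [Real.exp_neg, ← div_eq_mul_inv, div_le_iff₀ (Real.exp_pos _)] at hfin
  rwa [mul_comm]

/-! ### The characteristic function of the Cauchy distribution -/

section Cauchy

open Complex FourierTransform

theorem integral_exp_mul_I_mul_exp_neg_abs (x : ℝ) :
    ∫ v : ℝ, exp ((x * v : ℝ) * I) * (Real.exp (-|v|) : ℂ) = 2 * ((1 + x ^ 2)⁻¹ : ℝ) := by
  have hm : ((-1 : ℂ) + x * I).re < 0 := by simp
  have hp : 0 < ((1 : ℂ) + x * I).re := by simp
  have h1 : Set.EqOn (fun v : ℝ => exp ((x * v : ℝ) * I) * (Real.exp (-|v|) : ℂ))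
      (fun v : ℝ => exp (((-1 : ℂ) + x * I) * v)) (Set.Ioi 0) := by
    intro v hv
    simp only [ofReal_exp, ← Complex.exp_add, abs_of_pos (Set.mem_Ioi.mp hv)]
    congr 1
    push_cast
    ring
  have h2 : Set.EqOn (fun v : ℝ => exp ((x * v : ℝ) * I) * (Real.exp (-|v|) : ℂ))
      (fun v : ℝ => exp (((1 : ℂ) + x * I) * v)) (Set.Iic 0) := by
    intro v hv
    simp only [ofReal_exp, ← Complex.exp_add, abs_of_nonpos (Set.mem_Iic.mp hv)]
    congr 1
    push_cast
    ring
  have i1 := integrableOn_exp_mul_complex_Ioi hm 0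
  have i2 := integrableOn_exp_mul_complex_Iic hp 0
  rw [← intervalIntegral.integral_Iic_add_Ioi (b := 0)
    (i2.congr_fun h2.symm measurableSet_Iic) (i1.congr_fun h1.symm measurableSet_Ioi),
    setIntegral_congr_fun measurableSet_Ioi h1, setIntegral_congr_fun measurableSet_Iic h2,
    integral_exp_mul_complex_Ioi hm, integral_exp_mul_complex_Iic hp]
  have e1 : (-1 : ℂ) + x * I ≠ 0 := fun h => hm.ne (by rw [h]; simp)
  have e2 : (1 : ℂ) + x * I ≠ 0 := fun h => hp.ne' (by rw [h]; simp)
  have e3 : (1 : ℂ) + x ^ 2 ≠ 0 := by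
    have : (0 : ℝ) < 1 + x ^ 2 := by positivity
    exact_mod_cast this.ne'
  push_cast
  simp only [mul_zero, exp_zero]
  field_simp
  ring_nf
  rw [I_sq]
  ring

/-- Fourier inversion for `exp(-|v|)`, whose transform is the Cauchy density up to normalization. -/
theorem charFun_cauchyMeasure_zero_one (t : ℝ) :
    charFun (ProbabilityTheory.cauchyMeasure 0 1) t = (Real.exp (-|t|) : ℝ) := by
  set f : ℝ → ℂ := fun v => (Real.exp (-|v|) : ℂ) with hf
  have hfc : Continuous f := by fun_prop
  have hF : ∀ w : ℝ, 𝓕 f w = 2 * ((1 + (2 * Real.pi * w) ^ 2)⁻¹ : ℝ) := by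
    intro w
    rw [Real.fourier_eq']
    have := integral_exp_mul_I_mul_exp_neg_abs (-(2 * Real.pi * w))
    rw [neg_sq] at this
    rw [← this]
    refine integral_congr_ae (.of_forall fun v => ?_)
    simp only [smul_eq_mul, hf]
    congr 3
    simp
    ring
  -- If `f` were not integrable, its integral would be `0` by convention, while the preceding lemma
  -- at `x = 0` gives `2`.
  have hfi : Integrable f := by
    by_contra hni
    have h0 := integral_exp_mul_I_mul_exp_neg_abs 0
    simp only [zero_mul, ofReal_zero, exp_zero, one_mul] at h0
    rw [integral_undef hni] at h0
    norm_num at h0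
  have hFi : Integrable (𝓕 f) := by
    have : 𝓕 f = fun w : ℝ => (2 : ℂ) * ((1 + (2 * Real.pi * w) ^ 2)⁻¹ : ℝ) := funext hF
    rw [this]
    exact ((integrable_inv_one_add_sq.comp_mul_left' (by positivity :
      2 * Real.pi ≠ 0)).ofReal).const_mul 2
  have hinv := congrFun (hfc.fourierInv_fourier_eq hfi hFi) t
  -- The substitution `x = 2πw` passes from the `2π` normalization of `𝓕⁻` to that of `charFun`.
  have hcov : ∫ x : ℝ, exp (t * x * I) * ((Real.pi⁻¹ * (1 + x ^ 2)⁻¹ : ℝ) : ℂ) = 𝓕⁻ (𝓕 f) t := by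
    rw [Real.fourierInv_eq']
    have := Measure.integral_comp_mul_left
      (fun x : ℝ => exp (t * x * I) * ((Real.pi⁻¹ * (1 + x ^ 2)⁻¹ : ℝ) : ℂ)) (2 * Real.pi)
    rw [abs_of_pos (by positivity), eq_inv_smul_iff₀ (by positivity)] at this
    rw [← this, ← integral_smul]
    refine integral_congr_ae (.of_forall fun w => ?_)
    simp only [hF, smul_eq_mul, real_smul]
    have hpi : (Real.pi : ℂ) ≠ 0 := by exact_mod_cast Real.pi_ne_zero
    have : exp ((t : ℂ) * ((2 * Real.pi * w : ℝ) : ℂ) * I) =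
        exp (((2 * Real.pi * inner ℝ w t : ℝ) : ℂ) * I) := by
      congr 2
      simp
      ring
    rw [this]
    push_cast
    field_simp
  rw [charFun_apply_real, ← show f t = ((Real.exp (-|t|) : ℝ) : ℂ) from rfl, ← hinv, ← hcov,
    ProbabilityTheory.cauchyMeasure_of_scale_ne_zero _ one_ne_zero,
    integral_withDensity_eq_integral_toReal_smul
      (ProbabilityTheory.measurable_cauchyPDF 0 1) (.of_forall fun x => by
        simp [ProbabilityTheory.cauchyPDF])]
  refine integral_congr_ae (.of_forall fun x => ?_)
  have hnn : 0 ≤ Real.pi⁻¹ * (1 + x ^ 2)⁻¹ := by positivity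
  simp only [ProbabilityTheory.cauchyPDF, ProbabilityTheory.cauchyPDFReal_def, sub_zero,
    NNReal.coe_one, mul_one, one_pow, real_smul]
  rw [add_comm (x ^ 2), ENNReal.toReal_ofReal hnn, mul_comm]

/-- Scaling the standard Cauchy law by `γ`; for `γ = 0` the image is the Dirac mass at `0`, so that
case needs no separate treatment. -/
theorem exists_charFun_eq_exp_neg_abs (γ : ℝ≥0) :
    ∃ ν : Measure ℝ, IsProbabilityMeasure ν ∧
      ∀ t, charFun ν t = (Real.exp (-(γ * |t|)) : ℝ) := by
  refine ⟨(ProbabilityTheory.cauchyMeasure 0 1).map (γ * ·),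
    Measure.isProbabilityMeasure_map (by fun_prop), fun t => ?_⟩
  rw [charFun_map_mul, charFun_cauchyMeasure_zero_one, abs_mul, NNReal.abs_eq]

end Cauchy

/-! ### Coefficient multipliers -/

/-- The Dirichlet polynomial with coefficients `aₙ m(n)`. -/
def DirichletPoly.mulCoeff (m : ℕ+ → ℂ) (P : DirichletPoly) : DirichletPoly :=
  Finsupp.onFinset P.support (fun n => P n * m n)
    (fun _ h => Finsupp.mem_support_iff.2 (left_ne_zero_of_mul h))

@[simp]
theorem DirichletPoly.mulCoeff_apply (m : ℕ+ → ℂ) (P : DirichletPoly) (n : ℕ+) :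
    P.mulCoeff m n = P n * m n := rfl

@[simp]
theorem DirichletPoly.shift_apply (σ : ℝ≥0) (P : DirichletPoly) (n : ℕ+) :
    P.shift σ n = P n * ((n : ℕ) : ℂ) ^ (-((σ : ℝ) : ℂ)) := rfl

theorem DirichletPoly.shift_eq_mulCoeff (σ : ℝ≥0) (P : DirichletPoly) :
    P.shift σ = P.mulCoeff fun n => ((n : ℕ) : ℂ) ^ (-((σ : ℝ) : ℂ)) := rfl

theorem DirichletPoly.mulCoeff_shift (m : ℕ+ → ℂ) (σ : ℝ≥0) (P : DirichletPoly) :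
    (P.mulCoeff m).shift σ = (P.shift σ).mulCoeff m := by
  ext n
  simp only [shift_apply, mulCoeff_apply]
  ring

theorem DirichletPoly.shift_zero (P : DirichletPoly) : P.shift 0 = P := by
  ext n
  simp

theorem DirichletPoly.bohr_mulCoeff (m : ℕ+ → ℂ) (P : DirichletPoly) (χ : Polytorus) :
    (P.mulCoeff m).bohr χ = ∑ n ∈ P.support, P n * m n * (character χ n : ℂ) := by
  unfold DirichletPoly.bohr DirichletPoly.mulCoeff
  rw [Finsupp.onFinset_sum _ (by simp)]

theorem DirichletPoly.norm_bohr_le (P : DirichletPoly) (χ : Polytorus) :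
    ‖P.bohr χ‖ ≤ ∑ n ∈ P.support, ‖P n‖ := by
  simpa only [DirichletPoly.shift_zero] using norm_shift_bohr_le P 0 χ

theorem natCast_cpow_neg_eq_exp (n : ℕ+) (σ : ℝ≥0) :
    ((n : ℕ) : ℂ) ^ (-((σ : ℝ) : ℂ)) = (Real.exp (-(σ * |(-Real.log n)|)) : ℝ) := by
  rw [natCast_cpow_eq_exp n.ne_zero, abs_neg,
    abs_of_nonneg (Real.log_nonneg (by exact_mod_cast n.pos))]
  push_cast
  congr 1
  ring

theorem rpow_integral_le {α : Type*} [MeasurableSpace α] (ν : Measure α) [IsProbabilityMeasure ν]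
    {p : ℝ} (hp : 1 ≤ p) {g : α → ℝ} (hg0 : ∀ x, 0 ≤ g x) (hg : Integrable g ν)
    (hgp : Integrable (fun x => g x ^ p) ν) : (∫ x, g x ∂ν) ^ p ≤ ∫ x, g x ^ p ∂ν :=
  (convexOn_rpow hp).map_integral_le
    (Real.continuous_rpow_const (by linarith)).continuousOn isClosed_Ici
    (.of_forall hg0) hg hgp

/-- Since `charFun ν (-log n)` is the `ν`-average of `n^(-it)`, the new lift is the `ν`-average of
the translates of the old one along the flow. Jensen, Fubini and the invariance of `haar` conclude.
-/
theorem polyHardyNorm_mulCoeff_le {p : ℝ} (hp : 1 ≤ p) (ν : Measure ℝ) [IsProbabilityMeasure ν]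
    (P : DirichletPoly) :
    polyHardyNorm p (P.mulCoeff fun n => charFun ν (-Real.log n)) ≤ polyHardyNorm p P := by
  have h0 : 0 ≤ p := by linarith
  set C := ∑ n ∈ P.support, ‖P n‖
  have hC : 0 ≤ C := Finset.sum_nonneg fun _ _ => norm_nonneg _
  have hcont : Continuous fun x : Polytorus × ℝ => P.bohr (verticalFlow x.2 * x.1) :=
    (continuous_bohr P).comp ((continuous_verticalFlow.comp continuous_snd).mul continuous_fst)
  have hcontp : Continuous fun x : Polytorus × ℝ => ‖P.bohr (verticalFlow x.2 * x.1)‖ ^ p :=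
    hcont.norm.rpow_const fun _ => Or.inr h0
  have hrep : ∀ χ, (P.mulCoeff fun n => charFun ν (-Real.log n)).bohr χ =
      ∫ t, P.bohr (verticalFlow t * χ) ∂ν := by
    intro χ
    rw [DirichletPoly.bohr_mulCoeff]
    simp only [DirichletPoly.bohr, Finsupp.sum]
    have hterm : ∀ (n : ℕ+) (t : ℝ), P n * (character (verticalFlow t * χ) n : ℂ) =
        P n * (character χ n : ℂ) * Complex.exp (((-Real.log n : ℝ) * t : ℂ) * Complex.I) := by
      intro n t
      rw [character_mul, Circle.coe_mul, character_verticalFlow]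
      ring
    simp only [hterm]
    rw [integral_finsetSum]
    · refine Finset.sum_congr rfl fun n _ => ?_
      rw [integral_const_mul, charFun_apply_real]
      ring
    · intro n _
      refine Integrable.const_mul ?_ _
      refine Integrable.of_bound (by fun_prop) 1 (.of_forall fun t => ?_)
      rw [← Complex.ofReal_mul, Complex.norm_exp_ofReal_mul_I]
  have hpt : ∀ χ, ‖(P.mulCoeff fun n => charFun ν (-Real.log n)).bohr χ‖ ^ p ≤
      ∫ t, ‖P.bohr (verticalFlow t * χ)‖ ^ p ∂ν := by
    intro χ
    have hin : Continuous fun t : ℝ => (χ, t) := by fun_prop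
    rw [hrep χ]
    refine (Real.rpow_le_rpow (norm_nonneg _) (norm_integral_le_integral_norm _) h0).trans ?_
    refine rpow_integral_le ν hp (fun _ => norm_nonneg _) ?_ ?_
    · exact Integrable.of_bound (hcont.norm.comp hin).aestronglyMeasurable C
        (.of_forall fun t => by rw [norm_norm]; exact P.norm_bohr_le _)
    · refine Integrable.of_bound (hcontp.comp hin).aestronglyMeasurable (C ^ p)
        (.of_forall fun t => ?_)
      rw [Real.norm_of_nonneg (by positivity)]
      exact Real.rpow_le_rpow (norm_nonneg _) (P.norm_bohr_le _) h0
  have hprod : Integrable (fun x : Polytorus × ℝ => ‖P.bohr (verticalFlow x.2 * x.1)‖ ^ p)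
      (haar.prod ν) := by
    refine Integrable.of_bound hcontp.aestronglyMeasurable (C ^ p) (.of_forall fun x => ?_)
    rw [Real.norm_of_nonneg (by positivity)]
    exact Real.rpow_le_rpow (norm_nonneg _) (P.norm_bohr_le _) h0
  refine Real.rpow_le_rpow (integral_nonneg fun _ => by positivity) ?_ (by positivity)
  calc _ ≤ ∫ χ, ∫ t, ‖P.bohr (verticalFlow t * χ)‖ ^ p ∂ν ∂haar :=
        integral_mono_of_nonneg (.of_forall fun _ => by positivity) hprod.integral_prod_left
          (.of_forall hpt)
    _ = ∫ t, ∫ χ, ‖P.bohr (verticalFlow t * χ)‖ ^ p ∂haar ∂ν := integral_integral_swap hprod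
    _ = ∫ _, ∫ χ, ‖P.bohr χ‖ ^ p ∂haar ∂ν := by
        refine integral_congr_ae (.of_forall fun t => ?_)
        exact integral_haar_mul_left (fun χ => ‖P.bohr χ‖ ^ p) (verticalFlow t)
    _ = _ := by simp

/-! ### Bounds for the Hardy norm -/

theorem integral_norm_bohr_le_polyHardyNorm {p : ℝ} (hp : 1 ≤ p) (P : DirichletPoly) :
    ∫ χ, ‖P.bohr χ‖ ∂haar ≤ polyHardyNorm p P := by
  have h0 : 0 < p := by linarith
  have hc := (continuous_bohr P).norm
  have hi : 0 ≤ ∫ χ, ‖P.bohr χ‖ ∂haar := integral_nonneg fun _ => norm_nonneg _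
  have := rpow_integral_le haar hp (fun χ => norm_nonneg (P.bohr χ))
    (integrable_haar_of_continuous hc)
    (integrable_haar_of_continuous (hc.rpow_const fun _ => Or.inr h0.le))
  rw [polyHardyNorm, one_div]
  exact (Real.le_rpow_inv_iff_of_pos hi
    (integral_nonneg fun _ => Real.rpow_nonneg (norm_nonneg _) _) h0).2 this

theorem norm_coeff_le_polyHardyNorm {p : ℝ} (hp : 1 ≤ p) (P : DirichletPoly) (n : ℕ+) :
    ‖P n‖ ≤ polyHardyNorm p P :=
  (norm_coeff_le_integral P n).trans (integral_norm_bohr_le_polyHardyNorm hp P)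

/-- The bound for the point evaluations on the line `Re s = x`. -/
def evalBound (x : ℝ) : ℝ := Real.exp (2 * ∑' q : Nat.Primes, (q : ℝ) ^ (-2 * x))

theorem norm_eval_le_polyHardyNorm {p : ℝ} (hp : 1 ≤ p) (P : DirichletPoly) {s : ℂ}
    (hs : 1 / 2 < s.re) : ‖P.eval s‖ ≤ evalBound s.re * polyHardyNorm p P :=
  (norm_eval_le_integral P hs).trans (mul_le_mul_of_nonneg_left
    (integral_norm_bohr_le_polyHardyNorm hp P) (Real.exp_pos _).le)

theorem evalBound_anti {x y : ℝ} (hx : 1 / 2 < x) (hxy : x ≤ y) : evalBound y ≤ evalBound x := by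
  refine Real.exp_le_exp.2 (mul_le_mul_of_nonneg_left ?_ two_pos.le)
  refine Summable.tsum_le_tsum (fun q => ?_) (Nat.Primes.summable_rpow.2 (by linarith))
    (Nat.Primes.summable_rpow.2 (by linarith))
  exact Real.rpow_le_rpow_of_exponent_le (by exact_mod_cast q.2.one_lt.le) (by linarith)

theorem polyHardyNorm_le_sum {p : ℝ} (hp : 1 ≤ p) (P : DirichletPoly) :
    polyHardyNorm p P ≤ ∑ n ∈ P.support, ‖P n‖ := by
  simpa only [DirichletPoly.shift_zero] using polyHardyNorm_shift_le hp P 0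

theorem polyHardyNorm_shift_le_self {p : ℝ} (hp : 1 ≤ p) (P : DirichletPoly) (σ : ℝ≥0) :
    polyHardyNorm p (P.shift σ) ≤ polyHardyNorm p P := by
  obtain ⟨ν, hν, h⟩ := exists_charFun_eq_exp_neg_abs σ
  have := polyHardyNorm_mulCoeff_le hp ν P
  simpa only [h, ← natCast_cpow_neg_eq_exp, ← DirichletPoly.shift_eq_mulCoeff] using this

/-! ### Bounds for the Bergman norm -/

section Bergman

variable {p : ℝ} {μ : Measure ℝ≥0} [IsProbabilityMeasure μ]

theorem integrable_polyHardyNorm_shift_rpow (hp : 1 ≤ p) (P : DirichletPoly) :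
    Integrable (fun σ : ℝ≥0 => polyHardyNorm p (P.shift σ) ^ p) μ := by
  refine Integrable.of_bound ((measurable_polyHardyNorm_shift hp P).pow_const _).aestronglyMeasurable
    (polyHardyNorm p P ^ p) (.of_forall fun σ => ?_)
  have := polyHardyNorm_nonneg p (P.shift σ)
  rw [Real.norm_of_nonneg (by positivity)]
  exact Real.rpow_le_rpow this (polyHardyNorm_shift_le_self hp P σ) (by linarith)

theorem polyBergmanNorm_le_polyBergmanNorm (hp : 1 ≤ p) {P Q : DirichletPoly}
    (h : ∀ σ, polyHardyNorm p (P.shift σ) ≤ polyHardyNorm p (Q.shift σ)) :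
    polyBergmanNorm p μ P ≤ polyBergmanNorm p μ Q := by
  refine Real.rpow_le_rpow
    (integral_nonneg fun _ => Real.rpow_nonneg (polyHardyNorm_nonneg _ _) _) ?_ (by positivity)
  exact integral_mono (integrable_polyHardyNorm_shift_rpow hp P)
    (integrable_polyHardyNorm_shift_rpow hp Q)
    fun σ => Real.rpow_le_rpow (polyHardyNorm_nonneg _ _) (h σ) (by linarith)

theorem polyBergmanNorm_le_of_forall_le (hp : 1 ≤ p) {P : DirichletPoly} {C : ℝ}
    (h : ∀ σ, polyHardyNorm p (P.shift σ) ≤ C) : polyBergmanNorm p μ P ≤ C := by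
  have hC : 0 ≤ C := (polyHardyNorm_nonneg _ _).trans (h 0)
  have h0 : 0 < p := by linarith
  rw [polyBergmanNorm, one_div, Real.rpow_inv_le_iff_of_pos
    (integral_nonneg fun _ => Real.rpow_nonneg (polyHardyNorm_nonneg _ _) _) hC h0]
  refine (integral_mono (integrable_polyHardyNorm_shift_rpow hp P) (integrable_const (C ^ p))
    fun σ => Real.rpow_le_rpow (polyHardyNorm_nonneg _ _) (h σ) h0.le).trans_eq (by simp)

theorem polyBergmanNorm_le_sum (hp : 1 ≤ p) (P : DirichletPoly) :
    polyBergmanNorm p μ P ≤ ∑ n ∈ P.support, ‖P n‖ :=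
  polyBergmanNorm_le_of_forall_le hp fun σ => polyHardyNorm_shift_le hp P σ

theorem polyBergmanNorm_le_polyHardyNorm (hp : 1 ≤ p) (P : DirichletPoly) :
    polyBergmanNorm p μ P ≤ polyHardyNorm p P :=
  polyBergmanNorm_le_of_forall_le hp fun σ => polyHardyNorm_shift_le_self hp P σ

theorem polyBergmanNorm_mulCoeff_le (hp : 1 ≤ p) (ν : Measure ℝ) [IsProbabilityMeasure ν]
    (P : DirichletPoly) :
    polyBergmanNorm p μ (P.mulCoeff fun n => charFun ν (-Real.log n)) ≤ polyBergmanNorm p μ P :=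
  polyBergmanNorm_le_polyBergmanNorm hp fun σ => by
    rw [DirichletPoly.mulCoeff_shift]
    exact polyHardyNorm_mulCoeff_le hp ν _

/-- A Markov-type bound: it converts Hardy estimates uniform over small shifts into Bergman
estimates, at the cost of the mass of `[0, δ]`. -/
theorem mul_rpow_measureReal_Iic_le_polyBergmanNorm (hp : 1 ≤ p) {P : DirichletPoly} {δ : ℝ≥0}
    {x : ℝ} (hx : 0 ≤ x) (h : ∀ σ ≤ δ, x ≤ polyHardyNorm p (P.shift σ)) :
    x * μ.real (Set.Iic δ) ^ (1 / p) ≤ polyBergmanNorm p μ P := by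
  have h0 : 0 < p := by linarith
  have hint := integrable_polyHardyNorm_shift_rpow (μ := μ) hp P
  have hnn : ∀ σ, 0 ≤ polyHardyNorm p (P.shift σ) ^ p :=
    fun _ => Real.rpow_nonneg (polyHardyNorm_nonneg _ _) _
  have key : x ^ p * μ.real (Set.Iic δ) ≤ ∫ σ, polyHardyNorm p (P.shift σ) ^ p ∂μ := by
    calc x ^ p * μ.real (Set.Iic δ) = ∫ _ in Set.Iic δ, x ^ p ∂μ := by simp [mul_comm]
      _ ≤ ∫ σ in Set.Iic δ, polyHardyNorm p (P.shift σ) ^ p ∂μ :=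
          setIntegral_mono_on (integrable_const _) hint.integrableOn measurableSet_Iic
            fun σ hσ => Real.rpow_le_rpow hx (h σ hσ) h0.le
      _ ≤ _ := setIntegral_le_integral hint (.of_forall hnn)
  calc x * μ.real (Set.Iic δ) ^ (1 / p) = (x ^ p * μ.real (Set.Iic δ)) ^ (1 / p) := by
        rw [Real.mul_rpow (by positivity) measureReal_nonneg, ← Real.rpow_mul hx,
          mul_one_div_cancel h0.ne', Real.rpow_one]
    _ ≤ _ := Real.rpow_le_rpow (by positivity) key (by positivity)

theorem measureReal_Iic_pos (hμ : (0 : ℝ≥0) ∈ μ.support) {δ : ℝ≥0} (hδ : 0 < δ) :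
    0 < μ.real (Set.Iic δ) :=
  ENNReal.toReal_pos ((Measure.mem_support_iff_forall 0).1 hμ _ (Iic_mem_nhds hδ)).ne'
    (measure_ne_top _ _)

theorem exists_norm_coeff_le_polyBergmanNorm (hp : 1 ≤ p) (hμ : (0 : ℝ≥0) ∈ μ.support) :
    ∃ K : ℝ, 0 ≤ K ∧ ∀ (P : DirichletPoly) (n : ℕ+), ‖P n‖ ≤ K * n * polyBergmanNorm p μ P := by
  have hm : 0 < μ.real (Set.Iic 1) ^ (1 / p) :=
    Real.rpow_pos_of_pos (measureReal_Iic_pos hμ one_pos) _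
  refine ⟨(μ.real (Set.Iic 1) ^ (1 / p))⁻¹, by positivity, fun P n => ?_⟩
  have hn : (0 : ℝ) < n := by exact_mod_cast n.pos
  -- For `σ ≤ 1` the `n`-th coefficient of `P_σ` has modulus at least `|a_n|/n`. The choice `δ = 1`
  -- is a convenience: only polynomial growth in `n` matters later.
  have := mul_rpow_measureReal_Iic_le_polyBergmanNorm (μ := μ) hp (P := P) (δ := 1)
    (x := ‖P n‖ * (n : ℝ)⁻¹) (by positivity) fun σ hσ => by
      refine le_trans ?_ (norm_coeff_le_polyHardyNorm hp (P.shift σ) n)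
      rw [DirichletPoly.shift_apply, norm_mul, norm_natCast_cpow_neg, Complex.ofReal_re]
      refine mul_le_mul_of_nonneg_left ?_ (norm_nonneg _)
      rw [← Real.rpow_neg_one]
      exact Real.rpow_le_rpow_of_exponent_le (by exact_mod_cast n.pos)
        (neg_le_neg (by exact_mod_cast hσ))
  rw [← le_div_iff₀ hm, ← div_eq_mul_inv, div_le_iff₀ hn] at this
  refine this.trans_eq ?_
  ring

theorem exists_norm_eval_le_polyBergmanNorm (hp : 1 ≤ p) (hμ : (0 : ℝ≥0) ∈ μ.support) {s : ℂ}
    (hs : 1 / 2 < s.re) :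
    ∃ K : ℝ, 0 ≤ K ∧ ∀ P : DirichletPoly, ‖P.eval s‖ ≤ K * polyBergmanNorm p μ P := by
  -- Half the distance from `s` to the boundary line: for `σ ≤ δ`, `P(s) = P_σ(s - σ)` is an
  -- evaluation at a point that stays uniformly inside the half-plane.
  obtain ⟨δ, hδ0, hδ⟩ : ∃ δ : ℝ≥0, 0 < δ ∧ 1 / 2 < s.re - δ :=
    ⟨((s.re - 1 / 2) / 2).toNNReal, Real.toNNReal_pos.2 (by linarith),
      by rw [Real.coe_toNNReal _ (by linarith)]; linarith⟩
  have hm : 0 < μ.real (Set.Iic δ) ^ (1 / p) :=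
    Real.rpow_pos_of_pos (measureReal_Iic_pos hμ hδ0) _
  have hB : 0 < evalBound (s.re - δ) := Real.exp_pos _
  refine ⟨evalBound (s.re - δ) * (μ.real (Set.Iic δ) ^ (1 / p))⁻¹, by positivity, fun P => ?_⟩
  have := mul_rpow_measureReal_Iic_le_polyBergmanNorm (μ := μ) hp (P := P) (δ := δ)
    (x := (evalBound (s.re - δ))⁻¹ * ‖P.eval s‖) (by positivity) fun σ hσ => by
      have hσ' : (σ : ℝ) ≤ δ := by exact_mod_cast hσ
      have hre : (s - ((σ : ℝ) : ℂ)).re = s.re - σ := by simp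
      have h1 := norm_eval_le_polyHardyNorm hp (P.shift σ) (s := s - ((σ : ℝ) : ℂ))
        (by rw [hre]; linarith)
      rw [DirichletPoly.shift_eval, sub_add_cancel, hre] at h1
      rw [inv_mul_le_iff₀ hB]
      exact h1.trans (mul_le_mul_of_nonneg_right (evalBound_anti hδ (by linarith))
        (polyHardyNorm_nonneg _ _))
  rw [← le_div_iff₀ hm, inv_mul_le_iff₀ hB] at this
  refine this.trans_eq ?_
  ring

end Bergman

open UniformSpace (Completion)

/-! ### Limits of homomorphisms on completions -/

theorem exists_seq_tendsto_completion {A : Type*} [SeminormedAddCommGroup A] (F : Completion A) :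
    ∃ P : ℕ → A, Tendsto (fun j => (P j : Completion A)) atTop (𝓝 F) := by
  obtain ⟨u, hu, hlim⟩ := mem_closure_iff_seq_limit.1 (Completion.denseRange_coe (α := A) F)
  choose P hP using hu
  exact ⟨P, by simpa only [hP] using hlim⟩

theorem exists_forall_norm_le_of_tendsto_completion {A : Type*} [SeminormedAddCommGroup A]
    {F : Completion A} {P : ℕ → A} (hP : Tendsto (fun j => (P j : Completion A)) atTop (𝓝 F)) :
    ∃ M, ∀ j, ‖P j‖ ≤ M := by
  obtain ⟨M, hM⟩ := hP.norm.bddAbove_range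
  exact ⟨M, fun j => by simpa only [Completion.norm_coe] using hM ⟨j, rfl⟩⟩

theorem norm_completion_apply_le {A B : Type*} [SeminormedAddCommGroup A]
    [SeminormedAddCommGroup B] {T : NormedAddGroupHom A B} (hT : ∀ P, ‖T P‖ ≤ ‖P‖)
    (F : Completion A) : ‖T.completion F‖ ≤ ‖F‖ := by
  induction F using Completion.induction_on with
  | hp => exact isClosed_le T.completion.continuous.norm continuous_norm
  | ih P =>
    rw [NormedAddGroupHom.completion_coe, Completion.norm_coe, Completion.norm_coe]
    exact hT P

/-- Contractions converging to the identity on a dense subset converge to it everywhere, by an `ε/3`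
argument. -/
theorem tendsto_completion_apply {A ι : Type*} [SeminormedAddCommGroup A] {l : Filter ι}
    {T : ι → NormedAddGroupHom A A} (hT : ∀ i P, ‖T i P‖ ≤ ‖P‖)
    (hl : ∀ P, Tendsto (fun i => ‖T i P - P‖) l (𝓝 0)) (F : Completion A) :
    Tendsto (fun i => (T i).completion F) l (𝓝 F) := by
  rw [Metric.tendsto_nhds]
  intro ε hε
  obtain ⟨P, hP⟩ : ∃ P : A, dist F P < ε / 3 :=
    Completion.denseRange_coe.exists_dist_lt F (by positivity)
  filter_upwards [(hl P).eventually_lt_const (by positivity : 0 < ε / 3)] with i hi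
  have h1 : dist ((T i).completion F) ((T i).completion P) ≤ dist F P := by
    rw [dist_eq_norm, dist_eq_norm, ← map_sub]
    exact norm_completion_apply_le (hT i) _
  have h2 : dist ((T i).completion P) (P : Completion A) < ε / 3 := by
    rwa [NormedAddGroupHom.completion_coe, dist_eq_norm, ← Completion.coe_sub,
      Completion.norm_coe]
  have h3 := dist_triangle4 ((T i).completion F) ((T i).completion P) P F
  rw [dist_comm (P : Completion A) F] at h3
  linarith

/-! ### Norms on Dirichlet polynomials for which the completion is a space of functions -/

/-- An identification of a seminormed group with the Dirichlet polynomials such that the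
coefficients and the point evaluations in `ℂ_{1/2}` are bounded and such that the multiplication of
the coefficients by a positive definite function of `log n` is a contraction. -/
structure PolyModel (A : Type*) [SeminormedAddCommGroup A] where
  /-- The identification with the Dirichlet polynomials. -/
  equiv : A ≃+ DirichletPoly
  exists_norm_eval_le : ∀ s : HalfPlane, ∃ K : ℝ, ∀ P, ‖(equiv P).eval s‖ ≤ K * ‖P‖
  exists_norm_coeff_le : ∃ K : ℝ, 0 ≤ K ∧ ∀ P (n : ℕ+), ‖equiv P n‖ ≤ K * n * ‖P‖
  norm_le_sum : ∀ P, ‖P‖ ≤ ∑ n ∈ (equiv P).support, ‖equiv P n‖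
  norm_mulCoeff_le : ∀ (ν : Measure ℝ) [IsProbabilityMeasure ν] (P : A),
    ‖equiv.symm ((equiv P).mulCoeff fun n => charFun ν (-Real.log n))‖ ≤ ‖P‖

/-! ### Uniqueness of Dirichlet series and Gaussian damping of the coefficients. -/

theorem DirichletPoly.eval_add (P Q : DirichletPoly) (s : ℂ) :
    (P + Q).eval s = P.eval s + Q.eval s :=
  Finsupp.sum_add_index' (by simp) (by intros; ring)

theorem DirichletPoly.mulCoeff_add (m : ℕ+ → ℂ) (P Q : DirichletPoly) :
    (P + Q).mulCoeff m = P.mulCoeff m + Q.mulCoeff m := by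
  ext n
  simp [add_mul]

theorem DirichletPoly.eval_eq_tsum (P : DirichletPoly) (s : ℂ) :
    P.eval s = ∑' n : ℕ+, P n * ((n : ℕ) : ℂ) ^ (-s) := by
  rw [tsum_eq_sum (s := P.support) fun n hn => by simp [Finsupp.notMem_support_iff.1 hn]]
  rfl

theorem tsum_pnat_eq_LSeries {c : ℕ+ → ℂ} {f : ℕ → ℂ} (hf : ∀ n : ℕ+, f n = c n) (s : ℂ) :
    ∑' n : ℕ+, c n * ((n : ℕ) : ℂ) ^ (-s) = LSeries f s := by
  rw [LSeries, ← PNat.coe_injective.tsum_eq (f := fun n => LSeries.term f s n)]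
  · refine tsum_congr fun n => ?_
    rw [LSeries.term_of_ne_zero n.ne_zero, hf, Complex.cpow_neg, div_eq_mul_inv]
  · intro n hn
    have hn0 : n ≠ 0 := by
      rintro rfl
      exact hn (LSeries.term_zero f s)
    exact ⟨⟨n, Nat.pos_of_ne_zero hn0⟩, rfl⟩

theorem eq_zero_of_forall_tsum_eq_zero {c : ℕ+ → ℂ} {K : ℝ} (hc : ∀ n, ‖c n‖ ≤ K * n)
    (h : ∀ x : ℝ, 2 < x → ∑' n : ℕ+, c n * ((n : ℕ) : ℂ) ^ (-(x : ℂ)) = 0) (n : ℕ+) : c n = 0 := by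
  set f : ℕ → ℂ := fun n => if hn : 0 < n then c ⟨n, hn⟩ else 0 with hfdef
  have hf : ∀ n : ℕ+, f n = c n := fun n => dif_pos n.pos
  -- Linear growth of the coefficients puts the abscissa of absolute convergence at most at `2`.
  -- This excludes the nowhere convergent series, whose junk value `0` would also satisfy the
  -- hypothesis.
  have habs : LSeries.abscissaOfAbsConv f ≠ ⊤ := by
    have := LSeries.abscissaOfAbsConv_le_of_le_const_mul_rpow (f := f) (x := 1) ⟨K, fun n hn => by
      have : f n = c ⟨n, Nat.pos_of_ne_zero hn⟩ := dif_pos (Nat.pos_of_ne_zero hn)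
      rw [this, Real.rpow_one]
      exact hc _⟩
    intro htop
    rw [htop, top_le_iff] at this
    exact EReal.coe_ne_top 2 (by rw [← this]; norm_num; rfl)
  have hzero : (fun x : ℝ => LSeries f x) =ᶠ[atTop] 0 := by
    filter_upwards [eventually_gt_atTop 2] with x hx
    rw [← tsum_pnat_eq_LSeries hf, h x hx]
    rfl
  rw [← hf]
  exact (LSeries_eventually_eq_zero_iff'.1 hzero).resolve_right habs n n.ne_zero

theorem summable_pnat_rpow {r : ℝ} (hr : r < -1) : Summable fun n : ℕ+ => ((n : ℕ) : ℝ) ^ r :=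
  (Real.summable_nat_rpow.2 hr).comp_injective PNat.coe_injective

theorem charFun_gaussianReal_neg_log (v : ℝ≥0) (n : ℕ+) :
    charFun (ProbabilityTheory.gaussianReal 0 v) (-Real.log n) =
      (Real.exp (-(v * Real.log n ^ 2 / 2)) : ℝ) := by
  rw [ProbabilityTheory.charFun_gaussianReal]
  push_cast
  congr 1
  ring

/-- Completing the square in `log n`: Gaussian damping absorbs the growth `n` allowed to the
coefficients and leaves a summable `n^(-2)`. -/
theorem natCast_mul_exp_neg_sq_log_le {v : ℝ} (hv : 0 < v) (n : ℕ+) :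
    (n : ℝ) * Real.exp (-(v * Real.log n ^ 2 / 2)) ≤
      Real.exp (9 / (2 * v)) * ((n : ℕ) : ℝ) ^ (-2 : ℝ) := by
  have hn : (0 : ℝ) < n := by exact_mod_cast n.pos
  rw [Real.rpow_def_of_pos hn, ← Real.exp_add]
  nth_rewrite 1 [← Real.exp_log hn]
  rw [← Real.exp_add, Real.exp_le_exp]
  have h : 9 / (2 * v) + Real.log n * -2 - (Real.log n + -(v * Real.log n ^ 2 / 2)) =
      (v * Real.log n - 3) ^ 2 / (2 * v) := by
    field_simp
    ring
  have h2 : 0 ≤ (v * Real.log n - 3) ^ 2 / (2 * v) := by positivity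
  linarith

/-! ### The completion as a space of functions, and translation on it. -/

namespace PolyModel

variable {A : Type*} [SeminormedAddCommGroup A] (N : PolyModel A)

/-- The point evaluation at a point of `ℂ_{1/2}`. -/
def evalHom (s : HalfPlane) : NormedAddGroupHom A ℂ where
  toFun P := (N.equiv P).eval s
  map_add' P Q := by rw [map_add, DirichletPoly.eval_add]
  bound' := N.exists_norm_eval_le s

/-- The coefficient of `n^(-s)`. -/
def coeffHom (n : ℕ+) : NormedAddGroupHom A ℂ where
  toFun P := N.equiv P n
  map_add' P Q := by rw [map_add, Finsupp.add_apply]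
  bound' := by
    obtain ⟨K, -, hK⟩ := N.exists_norm_coeff_le
    exact ⟨K * n, fun P => hK P n⟩

/-- The contraction given by the multiplication of the coefficients by `m(n)`. -/
def mulCoeffHom (m : ℕ+ → ℂ) (hm : ∀ P, ‖N.equiv.symm ((N.equiv P).mulCoeff m)‖ ≤ ‖P‖) :
    NormedAddGroupHom A A where
  toFun P := N.equiv.symm ((N.equiv P).mulCoeff m)
  map_add' P Q := by rw [map_add, DirichletPoly.mulCoeff_add, map_add]
  bound' := ⟨1, fun P => by rw [one_mul]; exact hm P⟩

theorem norm_mulCoeff_sub_le (m : ℕ+ → ℂ) (P : A) :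
    ‖N.equiv.symm ((N.equiv P).mulCoeff m) - P‖ ≤
      ∑ n ∈ (N.equiv P).support, ‖N.equiv P n‖ * ‖m n - 1‖ := by
  have h : ∀ n, N.equiv (N.equiv.symm ((N.equiv P).mulCoeff m) - P) n =
      N.equiv P n * (m n - 1) := by
    intro n
    rw [map_sub, AddEquiv.apply_symm_apply, Finsupp.sub_apply, DirichletPoly.mulCoeff_apply]
    ring
  refine (N.norm_le_sum _).trans ?_
  simp only [h, norm_mul]
  refine Finset.sum_le_sum_of_subset_of_nonneg (fun n hn => ?_) fun _ _ _ => by positivity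
  rw [Finsupp.mem_support_iff, h] at hn
  exact Finsupp.mem_support_iff.2 (left_ne_zero_of_mul hn)

theorem tendsto_norm_mulCoeff_sub {ι : Type*} {l : Filter ι} {m : ι → ℕ+ → ℂ}
    (hm : ∀ n, Tendsto (fun i => m i n) l (𝓝 1)) (P : A) :
    Tendsto (fun i => ‖N.equiv.symm ((N.equiv P).mulCoeff (m i)) - P‖) l (𝓝 0) := by
  refine squeeze_zero (fun _ => norm_nonneg _) (fun i => N.norm_mulCoeff_sub_le (m i) P) ?_
  rw [← Finset.sum_const_zero (s := (N.equiv P).support)]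
  refine tendsto_finsetSum _ fun n _ => ?_
  have := ((hm n).sub_const 1).norm.const_mul ‖N.equiv P n‖
  simpa using this

theorem norm_mulCoeff_le_tsum (m : ℕ+ → ℂ) (P : A) :
    ‖N.equiv.symm ((N.equiv P).mulCoeff m)‖ ≤ ∑' n, ‖N.equiv P n‖ * ‖m n‖ := by
  refine (N.norm_le_sum _).trans ?_
  rw [AddEquiv.apply_symm_apply, tsum_eq_sum (s := (N.equiv P).support)
    fun n hn => by simp [Finsupp.notMem_support_iff.1 hn]]
  simp only [DirichletPoly.mulCoeff_apply, norm_mul]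
  refine Finset.sum_le_sum_of_subset_of_nonneg (fun n hn => ?_) fun _ _ _ => by positivity
  exact Finsupp.mem_support_iff.2 (left_ne_zero_of_mul (Finsupp.mem_support_iff.1 hn))

/-- An element of the completion that vanishes on `ℂ_{1/2}` is zero. -/
theorem eq_zero_of_forall_eval_eq_zero (F : Completion A)
    (hF : ∀ s, (N.evalHom s).extension F = 0) : F = 0 := by
  obtain ⟨P, hP⟩ := exists_seq_tendsto_completion F
  obtain ⟨M, hM⟩ := exists_forall_norm_le_of_tendsto_completion hP
  obtain ⟨K, hK0, hK⟩ := N.exists_norm_coeff_le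
  have hKM : ∀ j (n : ℕ+), ‖N.equiv (P j) n‖ ≤ K * M * n := by
    intro j n
    refine (hK _ n).trans ?_
    rw [mul_right_comm]
    have := hM j
    gcongr
  have hlim : ∀ T : NormedAddGroupHom A ℂ,
      Tendsto (fun j => T (P j)) atTop (𝓝 (T.extension F)) := fun T => by
    simpa only [Function.comp_def, NormedAddGroupHom.extension_coe] using
      (T.extension.continuous.tendsto F).comp hP
  set c : ℕ+ → ℂ := fun n => (N.coeffHom n).extension F
  have hc : ∀ n, Tendsto (fun j => N.equiv (P j) n) atTop (𝓝 (c n)) :=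
    fun n => hlim (N.coeffHom n)
  have hcK : ∀ n, ‖c n‖ ≤ K * M * n :=
    fun n => le_of_tendsto (hc n).norm (.of_forall fun j => hKM j n)
  -- For real `x > 2`, the growth bound allows the limit in `j` to be taken inside the sum `P_j(x)`,
  -- so the Dirichlet series of `c` vanishes there.
  have hc0 : ∀ n, c n = 0 := by
    refine eq_zero_of_forall_tsum_eq_zero hcK fun x hx => ?_
    have h1 : Tendsto (fun j => (N.equiv (P j)).eval x) atTop (𝓝 0) := by
      have := hlim (N.evalHom ⟨x, by rw [Complex.ofReal_re]; linarith⟩)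
      rwa [hF] at this
    refine tendsto_nhds_unique ?_ h1
    simp only [DirichletPoly.eval_eq_tsum]
    refine tendsto_tsum_of_dominated_convergence
      (bound := fun n : ℕ+ => K * M * ((n : ℕ) : ℝ) ^ (1 - x))
      ((summable_pnat_rpow (by linarith)).mul_left _)
      (fun n => (hc n).mul_const _) (.of_forall fun j n => ?_)
    have hn : (0 : ℝ) < n := by exact_mod_cast n.pos
    rw [norm_mul, norm_natCast_cpow_neg, Complex.ofReal_re, sub_eq_add_neg, Real.rpow_add hn,
      Real.rpow_one, ← mul_assoc]
    exact mul_le_mul_of_nonneg_right (hKM j n) (by positivity)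
  -- A Gaussian rather than a translation: the factor `n^(-c)` with `c` small would not make
  -- coefficients of linear growth summable.
  set m : ℝ≥0 → ℕ+ → ℂ :=
    fun v n => charFun (ProbabilityTheory.gaussianReal 0 v) (-Real.log n) with hm
  set T : ℝ≥0 → NormedAddGroupHom A A := fun v =>
    N.mulCoeffHom (m v) (N.norm_mulCoeff_le (ProbabilityTheory.gaussianReal 0 v))
  -- The norm is at most the `ℓ¹` norm of the coefficients; after damping these are dominated
  -- uniformly in `j` and tend to `0` termwise, so `T v (P j)` tends to `0` in norm.
  have hT0 : ∀ v : ℝ≥0, 0 < v → (T v).completion F = 0 := by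
    intro v hv
    have h1 : Tendsto (fun j => ((T v (P j) : A) : Completion A)) atTop
        (𝓝 ((T v).completion F)) := by
      simpa only [Function.comp_def, NormedAddGroupHom.completion_coe] using
        ((T v).completion.continuous.tendsto F).comp hP
    refine tendsto_nhds_unique h1 (squeeze_zero_norm (fun j => ?_)
      (?_ : Tendsto (fun j => ∑' n, ‖N.equiv (P j) n‖ * ‖m v n‖) atTop (𝓝 0)))
    · rw [Completion.norm_coe]
      exact N.norm_mulCoeff_le_tsum (m v) (P j)
    · have hz : ∑' n, ‖c n‖ * ‖m v n‖ = 0 := by simp [hc0]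
      rw [← hz]
      refine tendsto_tsum_of_dominated_convergence
        (bound := fun n : ℕ+ => K * M * (Real.exp (9 / (2 * v)) * ((n : ℕ) : ℝ) ^ (-2 : ℝ)))
        (((summable_pnat_rpow (by norm_num)).mul_left _).mul_left _)
        (fun n => (hc n).norm.mul_const _) (.of_forall fun j n => ?_)
      have hKM0 : 0 ≤ K * M := mul_nonneg hK0 ((norm_nonneg _).trans (hM j))
      rw [norm_mul, norm_norm, norm_norm, hm]
      simp only
      rw [charFun_gaussianReal_neg_log, Complex.norm_real, Real.norm_of_nonneg (Real.exp_pos _).le]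
      refine (mul_le_mul_of_nonneg_right (hKM j n) (Real.exp_pos _).le).trans ?_
      rw [mul_assoc]
      exact mul_le_mul_of_nonneg_left (natCast_mul_exp_neg_sq_log_le (by exact_mod_cast hv) n) hKM0
  have hTF : Tendsto (fun v => (T v).completion F) (𝓝[>] 0) (𝓝 F) := by
    refine tendsto_completion_apply
      (fun v => N.norm_mulCoeff_le (ProbabilityTheory.gaussianReal 0 v))
      (N.tendsto_norm_mulCoeff_sub fun n => ?_) F
    have hcont : Continuous fun v : ℝ≥0 =>
        ((Real.exp (-(v * Real.log n ^ 2 / 2)) : ℝ) : ℂ) := by fun_prop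
    have := (hcont.tendsto 0).mono_left (nhdsWithin_le_nhds (s := Set.Ioi 0))
    simp only [hm, charFun_gaussianReal_neg_log]
    simpa using this
  refine tendsto_nhds_unique hTF (tendsto_const_nhds.congr' ?_)
  filter_upwards [self_mem_nhdsWithin] with v hv
  exact (hT0 v hv).symm

/-- The function on `ℂ_{1/2}` defined by an element of the completion. -/
def toFun (F : Completion A) : HalfPlane → ℂ := fun s => (N.evalHom s).extension F

theorem toFun_injective : Function.Injective N.toFun := by
  intro F G h
  rw [← sub_eq_zero]
  refine N.eq_zero_of_forall_eval_eq_zero _ fun s => ?_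
  rw [map_sub, sub_eq_zero]
  exact congrFun h s

theorem norm_shift_le (c : ℝ≥0) (P : A) :
    ‖N.equiv.symm ((N.equiv P).mulCoeff fun n => ((n : ℕ) : ℂ) ^ (-((c : ℝ) : ℂ)))‖ ≤ ‖P‖ := by
  obtain ⟨ν, hν, h⟩ := exists_charFun_eq_exp_neg_abs c
  have := N.norm_mulCoeff_le ν P
  simpa only [h, ← natCast_cpow_neg_eq_exp] using this

/-- The translation `f ↦ f_c` on the completion. -/
def translate (c : ℝ≥0) : NormedAddGroupHom (Completion A) (Completion A) :=
  (N.mulCoeffHom _ (N.norm_shift_le c)).completion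

theorem translate_coe (c : ℝ≥0) (P : A) :
    N.translate c P = ((N.equiv.symm ((N.equiv P).shift c) : A) : Completion A) :=
  NormedAddGroupHom.completion_coe _ P

theorem norm_translate_le (c : ℝ≥0) (F : Completion A) : ‖N.translate c F‖ ≤ ‖F‖ :=
  norm_completion_apply_le (N.norm_shift_le c) F

/-- On a polynomial only finitely many factors `n^(-c)` have to tend to `1`; contractivity extends
this to the completion. -/
theorem tendsto_translate (F : Completion A) :
    Tendsto (fun c => N.translate c F) (𝓝[>] 0) (𝓝 F) := by
  refine tendsto_completion_apply N.norm_shift_le (N.tendsto_norm_mulCoeff_sub fun n => ?_) F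
  have hcont : Continuous fun c : ℝ≥0 => ((n : ℕ) : ℂ) ^ (-((c : ℝ) : ℂ)) := by
    simp only [natCast_cpow_neg_eq_exp]
    fun_prop
  have := (hcont.tendsto 0).mono_left (nhdsWithin_le_nhds (s := Set.Ioi 0))
  simpa using this

theorem toFun_translate (c : ℝ≥0) (F : Completion A) :
    N.toFun (N.translate c F) = horizontalTranslate c (N.toFun F) := by
  funext s
  unfold toFun horizontalTranslate
  induction F using Completion.induction_on with
  | hp =>
    exact isClosed_eq ((NormedAddGroupHom.continuous _).comp (NormedAddGroupHom.continuous _))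
      (NormedAddGroupHom.continuous _)
  | ih P =>
    simp only [translate_coe, NormedAddGroupHom.extension_coe]
    change (N.equiv (N.equiv.symm ((N.equiv P).shift c))).eval s = (N.equiv P).eval _
    rw [AddEquiv.apply_symm_apply, DirichletPoly.shift_eval]

/-- The infimum of the norms of the elements that define a given function is the norm of the unique
such element. -/
theorem sInf_norm_eq (F : Completion A) :
    sInf {r : ℝ | ∃ G : Completion A, N.toFun G = N.toFun F ∧ r = ‖G‖} = ‖F‖ := by
  have : {r : ℝ | ∃ G : Completion A, N.toFun G = N.toFun F ∧ r = ‖G‖} = {‖F‖} := by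
    ext r
    constructor
    · rintro ⟨G, hG, rfl⟩
      rw [N.toFun_injective hG]
      rfl
    · rintro rfl
      exact ⟨F, rfl, rfl⟩
  rw [this, csInf_singleton]

end PolyModel

/-! ### The Hardy and Bergman models and the inclusion between them. -/

section Spaces

variable (p : ℝ) [hp : Fact (1 ≤ p)]

/-- The Dirichlet polynomials with the norm of `𝓗^p`. -/
def hardyModel : PolyModel (HardyPoly p) where
  equiv := AddEquiv.refl DirichletPoly
  exists_norm_eval_le s := ⟨_, fun P => norm_eval_le_polyHardyNorm hp.out P s.2⟩
  exists_norm_coeff_le := ⟨1, zero_le_one, fun P n => by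
    rw [one_mul]
    exact (norm_coeff_le_polyHardyNorm hp.out P n).trans
      (le_mul_of_one_le_left (polyHardyNorm_nonneg p P) (by exact_mod_cast n.pos))⟩
  norm_le_sum P := polyHardyNorm_le_sum hp.out P
  norm_mulCoeff_le ν _ P := polyHardyNorm_mulCoeff_le hp.out ν P

theorem hardyModel_toFun (F : HardyCompletion p) : (hardyModel p).toFun F = F.toFun := rfl

theorem hardyNorm_toFun (F : HardyCompletion p) : hardyNorm p F.toFun = ‖F‖ :=
  (hardyModel p).sInf_norm_eq F

variable (μ : Measure ℝ≥0) [IsProbabilityMeasure μ]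

/-- The Dirichlet polynomials with the norm of `𝓐^p_μ`. -/
def bergmanModel (hμ : (0 : ℝ≥0) ∈ μ.support) : PolyModel (BergmanPoly p μ) where
  equiv := AddEquiv.refl DirichletPoly
  exists_norm_eval_le s :=
    let ⟨K, _, hK⟩ := exists_norm_eval_le_polyBergmanNorm hp.out hμ s.2
    ⟨K, hK⟩
  exists_norm_coeff_le := exists_norm_coeff_le_polyBergmanNorm hp.out hμ
  norm_le_sum P := polyBergmanNorm_le_sum hp.out P
  norm_mulCoeff_le ν _ P := polyBergmanNorm_mulCoeff_le hp.out ν P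

variable {μ}

theorem bergmanModel_toFun (hμ : (0 : ℝ≥0) ∈ μ.support) (F : BergmanCompletion p μ) :
    (bergmanModel p μ hμ).toFun F = F.toFun := rfl

theorem bergmanNorm_toFun (hμ : (0 : ℝ≥0) ∈ μ.support) (F : BergmanCompletion p μ) :
    bergmanNorm p μ F.toFun = ‖F‖ :=
  (bergmanModel p μ hμ).sInf_norm_eq F

variable (μ)

/-- The identity of the Dirichlet polynomials, from the norm of `𝓗^p` to that of `𝓐^p_μ`. -/
def hardyToBergmanPoly : NormedAddGroupHom (HardyPoly p) (BergmanPoly p μ) where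
  toFun P := P.poly
  map_add' _ _ := rfl
  bound' := ⟨1, fun P => by
    rw [one_mul]
    exact polyBergmanNorm_le_polyHardyNorm hp.out P.poly⟩

/-- The inclusion of `𝓗^p` in `𝓐^p_μ`. -/
def hardyToBergman : NormedAddGroupHom (HardyCompletion p) (BergmanCompletion p μ) :=
  (hardyToBergmanPoly p μ).completion

theorem norm_hardyToBergman_le (F : HardyCompletion p) : ‖hardyToBergman p μ F‖ ≤ ‖F‖ :=
  norm_completion_apply_le
    (fun P : HardyPoly p => polyBergmanNorm_le_polyHardyNorm hp.out P.poly) F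

theorem hardyToBergman_coe (P : HardyPoly p) :
    hardyToBergman p μ P = ((hardyToBergmanPoly p μ P : BergmanPoly p μ) : BergmanCompletion p μ) :=
  NormedAddGroupHom.completion_coe _ P

variable {μ}

theorem toFun_hardyToBergman (hμ : (0 : ℝ≥0) ∈ μ.support) (F : HardyCompletion p) :
    (hardyToBergman p μ F).toFun = F.toFun := by
  rw [← bergmanModel_toFun p hμ, ← hardyModel_toFun]
  funext s
  unfold PolyModel.toFun
  induction F using Completion.induction_on with
  | hp =>
    exact isClosed_eq ((NormedAddGroupHom.continuous _).comp (NormedAddGroupHom.continuous _))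
      (NormedAddGroupHom.continuous _)
  | ih P =>
    simp only [hardyToBergman_coe, NormedAddGroupHom.extension_coe]
    rfl

/-- On polynomials the integral formula is the definition of the Bergman norm. -/
theorem norm_hardyToBergman_coe (P : HardyPoly p) :
    ‖hardyToBergman p μ P‖ =
      (∫ σ : ℝ≥0, ‖(hardyModel p).translate σ (P : HardyCompletion p)‖ ^ p ∂μ) ^ (1 / p) := by
  simp only [hardyToBergman_coe, PolyModel.translate_coe, Completion.norm_coe]
  rfl

/-- A pointwise limit of the corresponding functions for polynomials approximating `F`. -/
theorem measurable_norm_translate (F : HardyCompletion p) :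
    Measurable fun σ : ℝ≥0 => ‖(hardyModel p).translate σ F‖ := by
  obtain ⟨P, hP⟩ := exists_seq_tendsto_completion F
  refine measurable_of_tendsto_metrizable
    (f := fun j σ => ‖(hardyModel p).translate σ (P j : HardyCompletion p)‖) (fun j => ?_)
    (tendsto_pi_nhds.2 fun σ =>
      ((((hardyModel p).translate σ).continuous.tendsto F).comp hP).norm)
  simp only [PolyModel.translate_coe, Completion.norm_coe]
  exact measurable_polyHardyNorm_shift hp.out (P j).poly

theorem integrable_norm_translate_rpow (F : HardyCompletion p) :
    Integrable (fun σ : ℝ≥0 => ‖(hardyModel p).translate σ F‖ ^ p) μ := by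
  have h0 : 0 ≤ p := by linarith [hp.out]
  refine Integrable.of_bound ((measurable_norm_translate p F).pow_const p).aestronglyMeasurable
    (‖F‖ ^ p) (.of_forall fun σ => ?_)
  rw [Real.norm_of_nonneg (by positivity)]
  exact Real.rpow_le_rpow (norm_nonneg _) ((hardyModel p).norm_translate_le σ F) h0

/-- Both sides pass to the limit along polynomials tending to `F`. Contractivity of the translations
provides the constant `M ^ p` as dominating function, integrable because `μ` is finite. -/
theorem norm_hardyToBergman (F : HardyCompletion p) :
    ‖hardyToBergman p μ F‖ =
      (∫ σ : ℝ≥0, ‖(hardyModel p).translate σ F‖ ^ p ∂μ) ^ (1 / p) := by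
  have h0 : 0 < p := by linarith [hp.out]
  obtain ⟨P, hP⟩ := exists_seq_tendsto_completion F
  obtain ⟨M, hM⟩ := exists_forall_norm_le_of_tendsto_completion hP
  have h1 := (((hardyToBergman p μ).continuous.tendsto F).comp hP).norm
  refine tendsto_nhds_unique h1 ?_
  simp only [Function.comp_def, norm_hardyToBergman_coe]
  refine Tendsto.rpow_const ?_ (Or.inr (by positivity))
  refine tendsto_integral_of_dominated_convergence (fun _ => M ^ p)
    (fun j => (integrable_norm_translate_rpow p _).aestronglyMeasurable) (integrable_const _)
    (fun j => .of_forall fun σ => ?_) (.of_forall fun σ => ?_)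
  · rw [Real.norm_of_nonneg (by positivity)]
    refine Real.rpow_le_rpow (norm_nonneg _) ?_ h0.le
    refine ((hardyModel p).norm_translate_le σ _).trans ?_
    rw [Completion.norm_coe]
    exact hM j
  · exact ((((hardyModel p).translate σ).continuous.tendsto F).comp hP).norm.rpow_const
      (Or.inr h0.le)

end Spaces

end DirichletSeries

end

open DirichletSeries
theorem mainTheorem9 (p : ℝ) [Fact (1 ≤ p)] (μ : Measure ℝ≥0) [IsProbabilityMeasure μ]
    (hμ : (0 : ℝ≥0) ∈ μ.support) :
    (hardySpace p ⊆ bergmanSpace p μ ∧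
      ∀ f ∈ hardySpace p, bergmanNorm p μ f ≤ hardyNorm p f) ∧
    (∀ f ∈ hardySpace p,
      (∀ σ : ℝ≥0, horizontalTranslate σ f ∈ hardySpace p) ∧
      Integrable (fun σ : ℝ≥0 => hardyNorm p (horizontalTranslate σ f) ^ p) μ ∧
      bergmanNorm p μ f = (∫ σ : ℝ≥0, hardyNorm p (horizontalTranslate σ f) ^ p ∂μ) ^ (1 / p)) ∧
    (∀ f ∈ bergmanSpace p μ,
      (∀ c : ℝ≥0, 0 < c → horizontalTranslate c f ∈ bergmanSpace p μ) ∧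
      Tendsto (fun c : ℝ≥0 => bergmanNorm p μ (horizontalTranslate c f)) (𝓝[>] 0)
        (𝓝 (bergmanNorm p μ f))) := by
  -- Once translating a function is known to be translating the element that defines it, every claim
  -- becomes one about norms in the completions.
  have htr : ∀ (σ : ℝ≥0) (F : HardyCompletion p),
      horizontalTranslate σ F.toFun = HardyCompletion.toFun ((hardyModel p).translate σ F) :=
    fun σ F => ((hardyModel p).toFun_translate σ F).symm
  have htr' : ∀ (c : ℝ≥0) (F : BergmanCompletion p μ), horizontalTranslate c F.toFun =
      BergmanCompletion.toFun ((bergmanModel p μ hμ).translate c F) :=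
    fun c F => ((bergmanModel p μ hμ).toFun_translate c F).symm
  refine ⟨⟨?_, ?_⟩, ?_, ?_⟩
  · rintro _ ⟨F, rfl⟩
    exact ⟨hardyToBergman p μ F, toFun_hardyToBergman p hμ F⟩
  · rintro _ ⟨F, rfl⟩
    rw [hardyNorm_toFun, ← toFun_hardyToBergman p hμ, bergmanNorm_toFun p hμ]
    exact norm_hardyToBergman_le p μ F
  · rintro _ ⟨F, rfl⟩
    simp only [htr, hardyNorm_toFun]
    refine ⟨fun σ => ⟨_, rfl⟩, integrable_norm_translate_rpow p F, ?_⟩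
    rw [← toFun_hardyToBergman p hμ, bergmanNorm_toFun p hμ, norm_hardyToBergman]
  · rintro _ ⟨F, rfl⟩
    simp only [htr', bergmanNorm_toFun p hμ]
    exact ⟨fun c _ => ⟨_, rfl⟩, ((bergmanModel p μ hμ).tendsto_translate F).norm⟩
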